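/- **Model.** There are $n$ workers and $p$ firms, each divided into $K$ groups. Worker $i$ has type $k_i$, firm $j$ has type $\ell_j$ (types in $\{1,\dots,K\}$, given), and $n_k\ge 1$ is the number of workers of type $k$. Let $\theta_j\ge 0$ with $\sum_{j:\ell_j=\ell}\theta_j=1$ for every $\ell$, and let $C\in\mathbb R^{K\times K}$ have entries $C(k,\ell)\ge 0$; write $C(k,\cdot)=\sum_\ell C(k,\ell)$ and $C(\cdot,\ell)=\sum_k C(k,\ell)$. The links $d_{ij}\in\{0,1\}$ are independent Bernoulli variables with success probabilities $p_{ij}=\frac1{n_{k_i}}\theta_jC(k_i,\ell_j)\le 1$. Put $B=(d_{ij})$ and $\mathfrak B=\mathbb E B=(p_{ij})$. There is one observation for each linked pair, so $N=\sum_{i,j}d_{ij}$, and $W\in\{0,1\}^{N\times n}$, $F\in\{0,1\}^{N\times p}$ associate observations with workers and firms. The outcome is $Y=W\mu+F\phi+U$, where $\mu=Z_w\mu^*+U_w$ and $\phi=Z_f\phi^*+U_f$; here $Z_w=(\mathbf 1\{k_i=k\})_{i,k}$ and $Z_f=(\mathbf 1\{\ell_j=\ell\})_{j,\ell}$ are the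 type-selection matrices, $\mu^*,\phi^*\in\mathbb R^K$ are fixed, and the vectors $U_w,U_f$ and the family of errors $(u_{ij})_{i,j}$ (the observation on the linked pair $(i,j)$ has error $u_{ij}$) have integrable entries with mean zero and are each independent of the network $(d_{ij})$. For $\lambda_w,\lambda_f>0$ the ridge estimator is $$\begin{pmatrix}\widehat\mu\\ \widehat\phi\end{pmatrix}=\begin{pmatrix}W^\top W+\lambda_wI_n & W^\top F\\ F^\top W& F^\top F+\lambda_fI_p\end{pmatrix}^{-1}\begin{pmatrix}W^\top Y\\F^\top Y\end{pmatrix},$$ and its conditional bias vectors given the network are $b_{\mu,\lambda}=\mathbb E(\widehat\mu-\mu\mid (d_{ij}))$ and $b_{\phi,\lambda}=\mathbb E(\widehat\phi-\phi\mid (d_{ij}))$. Let $\mathfrak D_{w,\lambda}=\mathrm{diag}(\sum_jp_{ij}+\lambda_w)$ and $\mathfrak D_{f,\lambda}=\mathrm{diag}(\sum_ip_{ij}+\lambda_f)$. The deterministic equivalents are $$\mathfrak b_{\mu,\lambda}=\bigl(\mathfrak D_{w,\lambda}-\mathfrak B\mathfrak D_{f,\lambda}^{-1}\mathfrak B^\top\bigr)^{-1}\bigl(-\lambda_wZ_w\mu^*+\lambda_f\mathfrak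 B\mathfrak D_{f,\lambda}^{-1}Z_f\phi^*\bigr),$$ $$\mathfrak b_{\phi,\lambda}=\bigl(\mathfrak D_{f,\lambda}-\mathfrak B^\top\mathfrak D_{w,\lambda}^{-1}\mathfrak B\bigr)^{-1}\bigl(-\lambda_fZ_f\phi^*+\lambda_w\mathfrak B^\top\mathfrak D_{w,\lambda}^{-1}Z_w\mu^*\bigr).$$ Let $\underline\delta_w=\min_k\frac{C(k,\cdot)}{n_k}$, $\overline\delta_w=\max_k\frac{C(k,\cdot)}{n_k}$, $\underline\delta_f=\min_j\theta_jC(\cdot,\ell_j)$, $\overline\delta_f=\max_j\theta_jC(\cdot,\ell_j)$, $\gamma=p/n$, $M=\max\bigl((\underline\delta_w+\lambda_w)^{-1},(\underline\delta_f+\lambda_f)^{-1}\bigr)$, $\chi_f=\max\bigl(1,\frac{\overline\delta_w}{\underline\delta_f+\lambda_f}\bigr)$, $\chi_w=\max\bigl(1,\frac{\overline\delta_f}{\underline\delta_w+\lambda_w}\bigr)$. **Theorem.** Let $\epsilon>0$, suppose $M\le\bigl(3\ln\frac{n+p}\epsilon\bigr)^{-1}$ (in particular $\epsilon<n+p$),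 and put $t=\sqrt{3M\ln\frac{n+p}{\epsilon}}$. Then, with Euclidean norms, with probability at least $1-\frac{11+7\gamma}{1+\gamma}\epsilon$, $$\begin{aligned}\|b_{\mu,\lambda}-\mathfrak b_{\mu,\lambda}\|\le{}&\Bigl(5+16\tfrac{\overline\delta_w+\lambda_w}{\underline\delta_w+\lambda_w}\Bigr)\tfrac{\overline\delta_w+\lambda_w}{\lambda_w^2}\,t\Bigl(\lambda_w\sqrt n\,\|\mu^*\|+\lambda_f\sqrt{\tfrac{\overline\delta_w+\lambda_w}{\underline\delta_f+\lambda_f}}\sqrt p\,\|\phi^*\|\Bigr)\\&+2\lambda_f\tfrac{\overline\delta_w+\lambda_w}{\lambda_w^2}\Bigl(\sqrt{\chi_f}+2\sqrt{\tfrac{\overline\delta_w+\lambda_w}{\lambda_f}}\Bigr)t\sqrt p\,\|\phi^*\|,\end{aligned}$$ and with probability at least $1-\frac{6+12\gamma}{1+\gamma}\epsilon$, $$\begin{aligned}\|b_{\phi,\lambda}-\mathfrak b_{\phi,\lambda}\|\le{}&\Bigl(5+16\tfrac{\overline\delta_f+\lambda_f}{\underline\delta_f+\lambda_f}\Bigr)\tfrac{\overline\delta_f+\lambda_f}{\lambda_f^2}\,t\Bigl(\lambda_f\sqrt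 p\,\|\phi^*\|+\lambda_w\sqrt{\tfrac{\overline\delta_f+\lambda_f}{\underline\delta_w+\lambda_w}}\sqrt n\,\|\mu^*\|\Bigr)\\&+2\lambda_w\tfrac{\overline\delta_f+\lambda_f}{\lambda_f^2}\Bigl(\sqrt{\chi_w}+2\sqrt{\tfrac{\overline\delta_f+\lambda_f}{\lambda_w}}\Bigr)t\sqrt n\,\|\mu^*\|.\end{aligned}$$ -/

import Mathlib

open MeasureTheory ProbabilityTheory Matrix

noncomputable section

/-! ### The degree-corrected bipartite stochastic block model -/

/-- Parameters of the block model with `n` workers, `p` firms and `K` groups on each side: the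
types `k i` and `l j`, the firm weights `theta j`, which sum to one within each firm group, and
the nonnegative affinity matrix `C`. Every worker group is inhabited. -/
structure BlockModel (n p K : ℕ) where
  k : Fin n → Fin K
  l : Fin p → Fin K
  theta : Fin p → ℝ
  C : Matrix (Fin K) (Fin K) ℝ
  k_surjective : Function.Surjective k
  theta_nonneg : ∀ j, 0 ≤ theta j
  theta_sum : ∀ a : Fin K, ∑ j with l j = a, theta j = 1
  C_nonneg : ∀ a b, 0 ≤ C a b

namespace BlockModel

variable {n p K : ℕ} (S : BlockModel n p K)

/-- Number `n_a` of workers of type `a`. -/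
def size (a : Fin K) : ℕ := (Finset.univ.filter fun i => S.k i = a).card

/-- The expected network `(p_{ij})`, with `p_{ij} = θ_j C(k_i, ℓ_j) / n_{k_i}`. -/
def meanB : Matrix (Fin n) (Fin p) ℝ :=
  Matrix.of fun i j => 1 / (S.size (S.k i) : ℝ) * S.theta j * S.C (S.k i) (S.l j)

/-- Expected degree `C(a, ·) / n_a` of a worker of type `a`. -/
def workerDegree (a : Fin K) : ℝ := 1 / (S.size a : ℝ) * ∑ b, S.C a b

/-- Expected degree `θ_j C(·, ℓ_j)` of firm `j`. -/
def firmDegree (j : Fin p) : ℝ := S.theta j * ∑ a, S.C a (S.l j)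

/-- Largest expected worker degree. -/
def maxW : ℝ := ⨆ a, S.workerDegree a
/-- Smallest expected worker degree. -/
def minW : ℝ := ⨅ a, S.workerDegree a
/-- Largest expected firm degree. -/
def maxF : ℝ := ⨆ j, S.firmDegree j
/-- Smallest expected firm degree. -/
def minF : ℝ := ⨅ j, S.firmDegree j

/-- Selection matrix of worker types. -/
def Zw : Matrix (Fin n) (Fin K) ℝ := Matrix.of fun i a => if S.k i = a then 1 else 0
/-- Selection matrix of firm types. -/
def Zf : Matrix (Fin p) (Fin K) ℝ := Matrix.of fun j b => if S.l j = b then 1 else 0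

/-- `M = max (M_f, M_w)`, with `M_w = (minW + lw)⁻¹` and `M_f = (minF + lf)⁻¹`. -/
def M (lw lf : ℝ) : ℝ := max (S.minF + lf)⁻¹ (S.minW + lw)⁻¹

/-- `t = √(3 M ln ((n + p) / ε))`. -/
def t (lw lf ε : ℝ) : ℝ := √(3 * S.M lw lf * Real.log (((n : ℝ) + p) / ε))

/-- `χ_f = max (1, maxW / (minF + lf))`. -/
def chiF (lf : ℝ) : ℝ := max 1 (S.maxW / (S.minF + lf))
/-- `χ_w = max (1, maxF / (minW + lw))`. -/
def chiW (lw : ℝ) : ℝ := max 1 (S.maxF / (S.minW + lw))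

end BlockModel

/-! ### The two-way model and its ridge estimator for a given network -/

namespace TwoWay

variable {n p : ℕ}

/-- The observations: one for each pair (worker, firm) linked in the network `g`. -/
abbrev Obs (g : Fin n → Fin p → Bool) : Type := {e : Fin n × Fin p // g e.1 e.2 = true}

/-- The matrix `W` that associates observations with workers. -/
def W (g : Fin n → Fin p → Bool) : Matrix (Obs g) (Fin n) ℝ :=
  Matrix.of fun o i => if o.1.1 = i then 1 else 0

/-- The matrix `F` that associates observations with firms. -/
def F (g : Fin n → Fin p → Bool) : Matrix (Obs g) (Fin p) ℝ :=
  Matrix.of fun o j => if o.1.2 = j then 1 else 0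

/-- The outcome `Y = W μ + F φ + U`; the error of the observation on the pair `(i, j)` is
`u i j`. -/
def Y (g : Fin n → Fin p → Bool) (mu : Fin n → ℝ) (phi : Fin p → ℝ) (u : Fin n → Fin p → ℝ) :
    Obs g → ℝ :=
  W g *ᵥ mu + F g *ᵥ phi + fun o => u o.1.1 o.1.2

/-- The two-way ridge estimator `(μ̂, φ̂)` computed from the outcome vector `y`. -/
def ridge (g : Fin n → Fin p → Bool) (lw lf : ℝ) (y : Obs g → ℝ) : Fin n ⊕ Fin p → ℝ :=
  (Matrix.fromBlocks ((W g)ᵀ * W g + lw • 1) ((W g)ᵀ * F g)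
      ((F g)ᵀ * W g) ((F g)ᵀ * F g + lf • 1))⁻¹ *ᵥ
    Sum.elim ((W g)ᵀ *ᵥ y) ((F g)ᵀ *ᵥ y)

/-! ### Conditional bias given the network -/

variable {Ω : Type*} [MeasurableSpace Ω]

/-- The conditional bias `E(μ̂ - μ | network)`, coordinate by coordinate. -/
def biasMu (P : Measure Ω) (G : Ω → Fin n → Fin p → Bool) (lw lf : ℝ)
    (mu : Ω → Fin n → ℝ) (phi : Ω → Fin p → ℝ) (U : Ω → Fin n → Fin p → ℝ) (ω : Ω) :
    EuclideanSpace ℝ (Fin n) :=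
  WithLp.toLp 2 fun i =>
    (P[fun x => ridge (G x) lw lf (Y (G x) (mu x) (phi x) (U x)) (Sum.inl i) - mu x i
      | MeasurableSpace.comap G inferInstance]) ω

/-- The conditional bias `E(φ̂ - φ | network)`, coordinate by coordinate. -/
def biasPhi (P : Measure Ω) (G : Ω → Fin n → Fin p → Bool) (lw lf : ℝ)
    (mu : Ω → Fin n → ℝ) (phi : Ω → Fin p → ℝ) (U : Ω → Fin n → Fin p → ℝ) (ω : Ω) :
    EuclideanSpace ℝ (Fin p) :=
  WithLp.toLp 2 fun j =>
    (P[fun x => ridge (G x) lw lf (Y (G x) (mu x) (phi x) (U x)) (Sum.inr j) - phi x j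
      | MeasurableSpace.comap G inferInstance]) ω

/-! ### Regularized Laplacians and deterministic equivalents of the biases -/

/-- Regularized worker degrees `D_{w,λ}` of a weighted bipartite network `B`. -/
def Dw (B : Matrix (Fin n) (Fin p) ℝ) (lw : ℝ) : Matrix (Fin n) (Fin n) ℝ :=
  Matrix.diagonal fun i => (∑ j, B i j) + lw

/-- Regularized firm degrees `D_{f,λ}` of a weighted bipartite network `B`. -/
def Df (B : Matrix (Fin n) (Fin p) ℝ) (lf : ℝ) : Matrix (Fin p) (Fin p) ℝ :=
  Matrix.diagonal fun j => (∑ i, B i j) + lf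

/-- Regularized un-normalized worker Laplacian `D_{w,λ} - B D_{f,λ}⁻¹ Bᵀ`. -/
def Lw (B : Matrix (Fin n) (Fin p) ℝ) (lw lf : ℝ) : Matrix (Fin n) (Fin n) ℝ :=
  Dw B lw - B * (Df B lf)⁻¹ * Bᵀ

/-- Regularized un-normalized firm Laplacian `D_{f,λ} - Bᵀ D_{w,λ}⁻¹ B`. -/
def Lf (B : Matrix (Fin n) (Fin p) ℝ) (lw lf : ℝ) : Matrix (Fin p) (Fin p) ℝ :=
  Df B lf - Bᵀ * (Dw B lw)⁻¹ * B

variable {K : ℕ}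

/-- Deterministic equivalent of the bias on the worker effects, from the expected network. -/
def meanBiasMu (S : BlockModel n p K) (lw lf : ℝ) (muStar phiStar : EuclideanSpace ℝ (Fin K)) :
    EuclideanSpace ℝ (Fin n) :=
  WithLp.toLp 2 ((Lw S.meanB lw lf)⁻¹ *ᵥ
    (-(lw • (S.Zw *ᵥ muStar.ofLp)) +
      lf • ((S.meanB * (Df S.meanB lf)⁻¹) *ᵥ (S.Zf *ᵥ phiStar.ofLp))))

/-- Deterministic equivalent of the bias on the firm effects, from the expected network. -/
def meanBiasPhi (S : BlockModel n p K) (lw lf : ℝ) (muStar phiStar : EuclideanSpace ℝ (Fin K)) :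
    EuclideanSpace ℝ (Fin p) :=
  WithLp.toLp 2 ((Lf S.meanB lw lf)⁻¹ *ᵥ
    (-(lf • (S.Zf *ᵥ phiStar.ofLp)) +
      lw • ((S.meanBᵀ * (Dw S.meanB lw)⁻¹) *ᵥ (S.Zw *ᵥ muStar.ofLp))))

end TwoWay

end

/-! Given the network, the noise averages out of the normal equations and leaves the right-hand side
`(-a m, -b v)`, where `a, b` are the worker and firm ridge parameters, `m = Z_w μ*` and `v = Z_f
φ*`. Eliminating the firm block (`lap_of_normalMatrix`), the worker bias `x` solves `L_B x = -a m +
b B D_B⁻¹ v`, with `L_B` the regularized worker Laplacian of the random network. The deterministic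
equivalent splits as `x₁ + x₂`, the solutions on the mean network `P` driven by `m` and by `v`.
Hence `L_B (x - x₁ - x₂) = b (B D_B⁻¹ - P D_P⁻¹) v - (L_B - L_P)(x₁ + x₂)`, and since `L_B ≥ a`
(`nrm_le_nrm_lap`) only the right-hand side has to be small.

No matrix concentration is needed, because the operators are compared only along fixed vectors:
scalar Bernstein bounds, one for each row or column, suffice. In the form `y² ≤ 4lV + 2lA|y|` they
can be summed. The variances add up to an `ℓ²` quantity and the linear terms to (sup norm) × (`ℓ¹`
norm). For `x₁` and `x₂` these norms come from a maximum principle for the Laplacian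
(`abs_le_of_abs_lap_le`) and its `ℓ¹` dual (`sum_abs_le_sum_abs_lap`). With Chernoff bounds on the
regularized degrees this gives the deterministic estimate `DegreesClose.nrm_bias_sub_le`.

A union bound over rows and columns costs `(8n + 6p) exp(-l)`, where `exp(-l) = ε / (n + p)` and `t²
= 3Ml`. The firm bound is the worker bound for the transposed network. -/

noncomputable section

namespace TwoWay

section Deterministic

variable {ι κ : Type*} [Fintype ι] [Fintype κ]

/-! ### The regularized Laplacian of a weighted bipartite network, acting on vectors -/

/-- The regularized Laplacian `D_{w,a} - B D_{f,b}⁻¹ Bᵀ` applied to the vector `x`. -/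
def lap (B : ι → κ → ℝ) (a b : ℝ) (x : ι → ℝ) (i : ι) : ℝ :=
  ((∑ j, B i j) + a) * x i - ∑ j, B i j * ((∑ i', B i' j * x i') / ((∑ i', B i' j) + b))

/-- The transfer `B D_{f,b}⁻¹ v` of a firm vector to workers. -/
def transfer (B : ι → κ → ℝ) (b : ℝ) (v : κ → ℝ) (i : ι) : ℝ :=
  ∑ j, B i j * (v j / ((∑ i', B i' j) + b))

/-- The Euclidean norm of a plain vector. -/
def nrm (x : ι → ℝ) : ℝ := ‖(WithLp.toLp 2 x : EuclideanSpace ℝ ι)‖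

lemma nrm_sq (x : ι → ℝ) : nrm x ^ 2 = ∑ i, x i ^ 2 := by
  simp [nrm, EuclideanSpace.real_norm_sq_eq]

lemma nrm_nonneg (x : ι → ℝ) : 0 ≤ nrm x := norm_nonneg _

lemma nrm_le {x : ι → ℝ} {c : ℝ} (hc : 0 ≤ c) (h : ∑ i, x i ^ 2 ≤ c ^ 2) : nrm x ≤ c := by
  rw [← nrm_sq] at h
  exact le_of_sq_le_sq h hc

lemma nrm_add_le (x y : ι → ℝ) : nrm (fun i => x i + y i) ≤ nrm x + nrm y :=
  norm_add_le (WithLp.toLp 2 x : EuclideanSpace ℝ ι) (WithLp.toLp 2 y)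

lemma nrm_sub_le (x y : ι → ℝ) : nrm (fun i => x i - y i) ≤ nrm x + nrm y :=
  norm_sub_le (WithLp.toLp 2 x : EuclideanSpace ℝ ι) (WithLp.toLp 2 y)

lemma nrm_mul (c : ℝ) (x : ι → ℝ) : nrm (fun i => c * x i) = |c| * nrm x :=
  norm_smul c (WithLp.toLp 2 x : EuclideanSpace ℝ ι)

/-- Interpolation between `ℓ^∞` and `ℓ¹`. Bernstein sums need the product `A * T` as well, so both
norms are tracked throughout. -/
lemma sum_sq_le_of_abs_le {x : ι → ℝ} {A T : ℝ} (hA : ∀ i, |x i| ≤ A) (hA0 : 0 ≤ A)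
    (hT : ∑ i, |x i| ≤ T) : ∑ i, x i ^ 2 ≤ A * T := by
  calc ∑ i, x i ^ 2 ≤ ∑ i, A * |x i| := by
        refine Finset.sum_le_sum fun i _ => ?_
        rw [← sq_abs, sq]
        exact mul_le_mul_of_nonneg_right (hA i) (abs_nonneg _)
    _ = A * ∑ i, |x i| := by rw [Finset.mul_sum]
    _ ≤ A * T := mul_le_mul_of_nonneg_left hT hA0

lemma sq_sum_mul_le {w : ι → ℝ} (hw : ∀ i, 0 ≤ w i) (x : ι → ℝ) :
    (∑ i, w i * x i) ^ 2 ≤ (∑ i, w i) * ∑ i, w i * x i ^ 2 :=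
  Finset.sum_sq_le_sum_mul_sum_of_sq_le_mul _ (fun i _ => hw i)
    (fun i _ => mul_nonneg (hw i) (sq_nonneg _)) (fun i _ => le_of_eq (by ring))

lemma abs_sum_mul_le {w : ι → ℝ} (hw : ∀ i, 0 ≤ w i) (x : ι → ℝ) :
    |∑ i, w i * x i| ≤ ∑ i, w i * |x i| :=
  (Finset.abs_sum_le_sum_abs _ _).trans_eq
    (Finset.sum_congr rfl fun i _ => by rw [abs_mul, abs_of_nonneg (hw i)])

section Laplacian

variable {B : ι → κ → ℝ} (hB : ∀ i j, 0 ≤ B i j) {a b : ℝ} (hb : 0 < b)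
include hB hb

omit [Fintype κ] in
lemma col_add_pos (j : κ) : 0 < (∑ i, B i j) + b :=
  add_pos_of_nonneg_of_pos (Finset.sum_nonneg fun i _ => hB i j) hb

/-- Averaging over a column with the regularized degree loses mass; all three stability bounds below
rest on this. -/
lemma mul_div_col_le {j : κ} {s : ℝ} (hs : 0 ≤ s) : (∑ i, B i j) * (s / ((∑ i, B i j) + b)) ≤ s := by
  have h := col_add_pos hB hb j
  rw [← mul_div_assoc, div_le_iff₀ h]
  nlinarith

/-- Cauchy–Schwarz in each column shows that the quadratic form of `B D_f⁻¹ Bᵀ` is at most that of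
the row degrees, so only the ridge term `a` is left. -/
lemma energy_le (x : ι → ℝ) : a * ∑ i, x i ^ 2 ≤ ∑ i, x i * lap B a b x i := by
  have h1 : ∑ i, x i * ∑ j, B i j * ((∑ i', B i' j * x i') / ((∑ i', B i' j) + b))
      = ∑ j, (∑ i', B i' j * x i') ^ 2 / ((∑ i', B i' j) + b) := by
    simp_rw [Finset.mul_sum]
    rw [Finset.sum_comm]
    refine Finset.sum_congr rfl fun j _ => ?_
    rw [sq, mul_div_assoc, Finset.sum_mul]
    exact Finset.sum_congr rfl fun i _ => by ring
  have h2 : ∑ j, (∑ i', B i' j * x i') ^ 2 / ((∑ i', B i' j) + b)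
      ≤ ∑ i, (∑ j, B i j) * x i ^ 2 := by
    calc _ ≤ ∑ j, ∑ i, B i j * x i ^ 2 := by
          refine Finset.sum_le_sum fun j _ => ?_
          have hQ : 0 ≤ ∑ i, B i j * x i ^ 2 :=
            Finset.sum_nonneg fun i _ => mul_nonneg (hB i j) (sq_nonneg _)
          refine le_trans ?_ (mul_div_col_le hB hb (j := j) hQ)
          rw [← mul_div_assoc]
          exact div_le_div_of_nonneg_right (sq_sum_mul_le (fun i => hB i j) x)
            (col_add_pos hB hb j).le
      _ = _ := by rw [Finset.sum_comm]; simp_rw [Finset.sum_mul]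
  have h3 : ∑ i, x i * lap B a b x i = (∑ i, (∑ j, B i j) * x i ^ 2) + a * ∑ i, x i ^ 2
      - ∑ i, x i * ∑ j, B i j * ((∑ i', B i' j * x i') / ((∑ i', B i' j) + b)) := by
    rw [Finset.mul_sum, ← Finset.sum_add_distrib, ← Finset.sum_sub_distrib]
    exact Finset.sum_congr rfl fun i _ => by rw [lap]; ring
  linarith

lemma nrm_le_nrm_lap (x : ι → ℝ) : a * nrm x ≤ nrm (lap B a b x) := by
  have h := energy_le hB hb (a := a) x
  have h2 : ∑ i, x i * lap B a b x i ≤ nrm x * nrm (lap B a b x) := by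
    refine abs_le_of_sq_le_sq ?_ (mul_nonneg (nrm_nonneg _) (nrm_nonneg _)) |>.trans' (le_abs_self _)
    rw [mul_pow, nrm_sq, nrm_sq]
    exact Finset.sum_mul_sq_le_sq_mul_sq _ _ _
  rw [← nrm_sq] at h
  rcases (nrm_nonneg x).eq_or_lt with h0 | h0
  · rw [← h0, mul_zero]; exact nrm_nonneg _
  · nlinarith

/-- Maximum principle: where `|x|` is largest, the averaging term is at most the row degree times
that maximum, which leaves `a |x i₀|`. -/
lemma abs_le_of_abs_lap_le (ha : 0 < a) {x : ι → ℝ} {A : ℝ} (hx : ∀ i, |lap B a b x i| ≤ A) (i : ι) :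
    |x i| ≤ A / a := by
  have : Nonempty ι := ⟨i⟩
  obtain ⟨i₀, h₀⟩ := Finite.exists_max fun i => |x i|
  refine (h₀ i).trans ?_
  rw [le_div_iff₀ ha]
  have h1 : |∑ j, B i₀ j * ((∑ i', B i' j * x i') / ((∑ i', B i' j) + b))|
      ≤ (∑ j, B i₀ j) * |x i₀| := by
    refine (abs_sum_mul_le (hB i₀) _).trans ?_
    rw [Finset.sum_mul]
    refine Finset.sum_le_sum fun j _ => mul_le_mul_of_nonneg_left ?_ (hB i₀ j)
    rw [abs_div, abs_of_pos (col_add_pos hB hb j)]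
    refine le_trans ?_ (mul_div_col_le hB hb (j := j) (abs_nonneg (x i₀)))
    rw [← mul_div_assoc]
    refine div_le_div_of_nonneg_right ?_ (col_add_pos hB hb j).le
    refine (abs_sum_mul_le (fun i => hB i j) _).trans ?_
    rw [Finset.sum_mul]
    exact Finset.sum_le_sum fun i _ => mul_le_mul_of_nonneg_left (h₀ i) (hB i j)
  have h2 : ((∑ j, B i₀ j) + a) * |x i₀| = |((∑ j, B i₀ j) + a) * x i₀| := by
    rw [abs_mul, abs_of_pos (add_pos_of_nonneg_of_pos (Finset.sum_nonneg fun j _ => hB i₀ j) ha)]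
  have h3 := abs_sub_abs_le_abs_sub (((∑ j, B i₀ j) + a) * x i₀)
    (∑ j, B i₀ j * ((∑ i', B i' j * x i') / ((∑ i', B i' j) + b)))
  have h4 := hx i₀
  rw [lap] at h4
  nlinarith

/-- The `ℓ¹` dual of the maximum principle: the averaging term has total mass at most that of the
degree term. -/
lemma sum_abs_le_sum_abs_lap (ha : 0 < a) (x : ι → ℝ) :
    a * ∑ i, |x i| ≤ ∑ i, |lap B a b x i| := by
  have h1 : ∀ i, ((∑ j, B i j) + a) * |x i|
      - ∑ j, B i j * ((∑ i', B i' j * |x i'|) / ((∑ i', B i' j) + b)) ≤ |lap B a b x i| := by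
    intro i
    refine le_trans ?_ (abs_sub_abs_le_abs_sub _ _)
    rw [abs_mul, abs_of_pos (add_pos_of_nonneg_of_pos (Finset.sum_nonneg fun j _ => hB i j) ha)]
    refine sub_le_sub_left ((abs_sum_mul_le (hB i) _).trans ?_) _
    refine Finset.sum_le_sum fun j _ => mul_le_mul_of_nonneg_left ?_ (hB i j)
    rw [abs_div, abs_of_pos (col_add_pos hB hb j)]
    exact div_le_div_of_nonneg_right (abs_sum_mul_le (fun i => hB i j) _) (col_add_pos hB hb j).le
  have h2 : ∑ i, ∑ j, B i j * ((∑ i', B i' j * |x i'|) / ((∑ i', B i' j) + b))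
      ≤ ∑ i, (∑ j, B i j) * |x i| := by
    rw [Finset.sum_comm]
    calc _ ≤ ∑ j, ∑ i, B i j * |x i| := by
          refine Finset.sum_le_sum fun j _ => ?_
          rw [← Finset.sum_mul]
          exact mul_div_col_le hB hb
            (Finset.sum_nonneg fun i _ => mul_nonneg (hB i j) (abs_nonneg _))
      _ = _ := by rw [Finset.sum_comm]; simp_rw [Finset.sum_mul]
  have h3 := Finset.sum_le_sum fun i (_ : i ∈ Finset.univ) => h1 i
  rw [Finset.sum_sub_distrib] at h3
  simp_rw [add_mul, Finset.sum_add_distrib] at h3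
  rw [← Finset.mul_sum] at h3
  linarith

lemma abs_transfer_le {v : κ → ℝ} {φ m R : ℝ} (hv : ∀ j, |v j| ≤ φ) (hφ : 0 ≤ φ)
    (hm0 : 0 ≤ m) (hm : ∀ j, ((∑ i', B i' j) + b)⁻¹ ≤ m) (hR : ∀ i, ∑ j, B i j ≤ R) (i : ι) :
    |transfer B b v i| ≤ R * m * φ := by
  refine (abs_sum_mul_le (hB i) _).trans ?_
  calc _ ≤ ∑ j, B i j * (m * φ) := by
        refine Finset.sum_le_sum fun j _ => mul_le_mul_of_nonneg_left ?_ (hB i j)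
        rw [abs_div, abs_of_pos (col_add_pos hB hb j), div_eq_inv_mul]
        exact mul_le_mul (hm j) (hv j) (abs_nonneg _) hm0
    _ = (∑ j, B i j) * (m * φ) := by rw [Finset.sum_mul]
    _ ≤ R * (m * φ) := mul_le_mul_of_nonneg_right (hR i) (mul_nonneg hm0 hφ)
    _ = _ := by ring

lemma sum_abs_transfer_le {v : κ → ℝ} {φ : ℝ} (hv : ∀ j, |v j| ≤ φ) :
    ∑ i, |transfer B b v i| ≤ Fintype.card κ * φ := by
  calc _ ≤ ∑ i, ∑ j, B i j * (|v j| / ((∑ i', B i' j) + b)) := by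
        refine Finset.sum_le_sum fun i _ => (abs_sum_mul_le (hB i) _).trans_eq ?_
        exact Finset.sum_congr rfl fun j _ => by rw [abs_div, abs_of_pos (col_add_pos hB hb j)]
    _ = ∑ j, (∑ i, B i j) * (|v j| / ((∑ i', B i' j) + b)) := by
        rw [Finset.sum_comm]; simp_rw [Finset.sum_mul]
    _ ≤ ∑ _j : κ, φ :=
        Finset.sum_le_sum fun j _ => (mul_div_col_le hB hb (abs_nonneg _)).trans (hv j)
    _ = _ := by simp

end Laplacian

lemma sum_sq_sum_mul_le {B : ι → κ → ℝ} (hB : ∀ i j, 0 ≤ B i j) {R : ℝ}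
    (hR : ∀ i, ∑ j, B i j ≤ R) (z : κ → ℝ) :
    ∑ i, (∑ j, B i j * z j) ^ 2 ≤ R * ∑ j, (∑ i, B i j) * z j ^ 2 := by
  calc _ ≤ ∑ i, R * ∑ j, B i j * z j ^ 2 := by
        refine Finset.sum_le_sum fun i _ => (sq_sum_mul_le (hB i) z).trans ?_
        exact mul_le_mul_of_nonneg_right (hR i)
          (Finset.sum_nonneg fun j _ => mul_nonneg (hB i j) (sq_nonneg _))
    _ = _ := by
        rw [← Finset.mul_sum, Finset.sum_comm]
        simp_rw [Finset.sum_mul]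

/-- Entrywise Bernstein bounds add up to a weighted Euclidean bound. -/
lemma sum_weight_sq_le {w y V : κ → ℝ} {l A s T v : ℝ} (hw : ∀ j, 0 ≤ w j)
    (hy : ∀ j, y j ^ 2 ≤ 4 * l * V j + 2 * l * A * |y j|) (hl : 0 ≤ l) (hA : 0 ≤ A)
    (hV : ∑ j, w j * V j ≤ v) (hT : ∑ j, w j * |y j| ≤ T)
    (h1 : l * v ≤ s / 3) (h2 : l * A * T ≤ s) : ∑ j, w j * y j ^ 2 ≤ 10 / 3 * s := by
  calc ∑ j, w j * y j ^ 2
      ≤ ∑ j, (4 * l * (w j * V j) + 2 * l * A * (w j * |y j|)) :=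
        Finset.sum_le_sum fun j _ =>
          (mul_le_mul_of_nonneg_left (hy j) (hw j)).trans_eq (by ring)
    _ = 4 * l * ∑ j, w j * V j + 2 * l * A * ∑ j, w j * |y j| := by
        rw [Finset.sum_add_distrib, Finset.mul_sum, Finset.mul_sum]
    _ ≤ 4 * l * v + 2 * l * A * T :=
        add_le_add (mul_le_mul_of_nonneg_left hV (by positivity))
          (mul_le_mul_of_nonneg_left hT (by positivity))
    -- The constant is `4/3 + 2 = 10/3`.
    _ ≤ _ := by linarith

/-! ### Comparison of a network with its mean -/

/-- Weighted sums of the deviations `B i j - P i j` along a row. -/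
def dev (B P : ι → κ → ℝ) (c : κ → ℝ) (i : ι) : ℝ := ∑ j, (B i j - P i j) * c j

/-- Bernstein-type bounds, at level `l` and with sup bound `A` on the weights, for the row
deviations. -/
def BernsteinRows (B P : ι → κ → ℝ) (l A : ℝ) (c : κ → ℝ) : Prop :=
  ∀ i, dev B P c i ^ 2 ≤ 4 * l * (∑ j, P i j * c j ^ 2) + 2 * l * A * |dev B P c i|

/-- The regularized degrees of `B` are within a factor `1 ± t` of those of `P`, and those of the
columns are not much smaller. -/
structure DegreesClose (B P : ι → κ → ℝ) (a b t : ℝ) : Prop where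
  left_nonneg : ∀ i j, 0 ≤ B i j
  right_nonneg : ∀ i j, 0 ≤ P i j
  row : ∀ i, |∑ j, B i j - ∑ j, P i j| ≤ t * ((∑ j, P i j) + a)
  col : ∀ j, |∑ i, B i j - ∑ i, P i j| ≤ t * ((∑ i, P i j) + b)
  col_lower : ∀ j, (∑ i, P i j) + b ≤ 9 * ((∑ i, B i j) + b)

omit [Fintype ι] in
lemma abs_dev_le {B P : ι → κ → ℝ} (hB : ∀ i j, 0 ≤ B i j) (hP : ∀ i j, 0 ≤ P i j) (c : κ → ℝ)
    (i : ι) : |dev B P c i| ≤ ∑ j, (B i j + P i j) * |c j| := by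
  refine (Finset.abs_sum_le_sum_abs _ _).trans (Finset.sum_le_sum fun j _ => ?_)
  rw [abs_mul]
  refine mul_le_mul_of_nonneg_right ?_ (abs_nonneg _)
  have h1 := hB i j
  have h2 := hP i j
  exact abs_le.2 ⟨by linarith, by linarith⟩

section Close

variable {B P : ι → κ → ℝ} {a b t : ℝ} (h : DegreesClose B P a b t) (ht : t ≤ 1)
include h ht

/-- In the linear Bernstein term the crude bound `|B - P| ≤ B + P` suffices, since `l * A` is
already small. Summed over columns it costs a factor 3, because `t ≤ 1`. -/
lemma DegreesClose.sum_sq_dev_le (hb : 0 < b) {c : κ → ℝ} {l A v T s : ℝ}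
    (hl : 0 ≤ l) (hA : 0 ≤ A) (hc : BernsteinRows B P l A c)
    (hv : ∑ j, ((∑ i, P i j) + b) * c j ^ 2 ≤ v) (hT : ∑ j, ((∑ i, P i j) + b) * |c j| ≤ T)
    (h1 : l * v ≤ s / 3) (h2 : l * A * (3 * T) ≤ s) :
    ∑ i, dev B P c i ^ 2 ≤ 10 / 3 * s := by
  have := sum_weight_sq_le (w := fun _ : ι => (1 : ℝ)) (y := dev B P c)
    (V := fun i => ∑ j, P i j * c j ^ 2) (fun _ => zero_le_one) hc hl hA (v := v) (T := 3 * T)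
    ?_ ?_ h1 h2
  · simpa using this
  · refine le_trans ?_ hv
    simp_rw [one_mul]
    rw [Finset.sum_comm]
    refine Finset.sum_le_sum fun j _ => ?_
    rw [← Finset.sum_mul]
    exact mul_le_mul_of_nonneg_right (by linarith) (sq_nonneg _)
  · simp_rw [one_mul]
    calc _ ≤ ∑ i, ∑ j, (B i j + P i j) * |c j| :=
          Finset.sum_le_sum fun i _ => abs_dev_le h.left_nonneg h.right_nonneg c i
      _ = ∑ j, ((∑ i, B i j) + ∑ i, P i j) * |c j| := by
          rw [Finset.sum_comm]
          exact Finset.sum_congr rfl fun j _ => by rw [← Finset.sum_mul, Finset.sum_add_distrib]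
      _ ≤ ∑ j, 3 * (((∑ i, P i j) + b) * |c j|) := by
          refine Finset.sum_le_sum fun j _ => ?_
          rw [← mul_assoc]
          refine mul_le_mul_of_nonneg_right ?_ (abs_nonneg _)
          have h3 := (abs_le.1 (h.col j)).2
          have h4 := mul_le_of_le_one_left (col_add_pos h.right_nonneg hb j).le ht
          linarith
      _ = 3 * ∑ j, ((∑ i, P i j) + b) * |c j| := by rw [Finset.mul_sum]
      _ ≤ _ := by linarith

lemma DegreesClose.row_le {R : ℝ} (ha : 0 < a) (hR : ∀ i, (∑ j, P i j) + a ≤ R) (i : ι) :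
    ∑ j, B i j ≤ 2 * R := by
  have h3 := (abs_le.1 (h.row i)).2
  have h5 : 0 ≤ ∑ j, P i j := Finset.sum_nonneg fun j _ => h.right_nonneg i j
  have h4 := mul_le_of_le_one_left (show 0 ≤ (∑ j, P i j) + a by linarith) ht
  have := hR i
  linarith

lemma DegreesClose.sum_sq_colDev_le (ha : 0 < a) (hb : 0 < b) {x : ι → ℝ} {l A T s M R Q : ℝ}
    (hl : 0 ≤ l) (hA : 0 ≤ A)
    (hx : BernsteinRows (fun j i => B i j) (fun j i => P i j) l A x)
    (hM0 : 0 ≤ M) (hM : ∀ j, ((∑ i, P i j) + b)⁻¹ ≤ M) (hR : ∀ i, (∑ j, P i j) + a ≤ R)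
    (hR0 : 0 ≤ R) (hQ : ∑ i, x i ^ 2 ≤ Q) (hT : ∑ i, |x i| ≤ T)
    (h1 : l * (M * R * Q) ≤ s / 3) (h2 : l * A * (M * (3 * R * T)) ≤ s) :
    ∑ j, ((∑ i, P i j) + b)⁻¹ * dev (fun j i => B i j) (fun j i => P i j) x j ^ 2
      ≤ 10 / 3 * s := by
  have hE := fun j => (col_add_pos h.right_nonneg hb j)
  refine sum_weight_sq_le (fun j => (inv_pos.2 (hE j)).le) hx hl hA ?_ ?_ h1 h2
  · calc _ ≤ ∑ j, M * ∑ i, P i j * x i ^ 2 :=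
          Finset.sum_le_sum fun j _ => mul_le_mul_of_nonneg_right (hM j)
            (Finset.sum_nonneg fun i _ => mul_nonneg (h.right_nonneg i j) (sq_nonneg _))
      _ = M * ∑ i, (∑ j, P i j) * x i ^ 2 := by
          rw [← Finset.mul_sum, Finset.sum_comm]; simp_rw [Finset.sum_mul]
      _ ≤ M * ∑ i, R * x i ^ 2 := by
          refine mul_le_mul_of_nonneg_left (Finset.sum_le_sum fun i _ => ?_) hM0
          exact mul_le_mul_of_nonneg_right (by linarith [hR i]) (sq_nonneg _)
      _ = M * R * ∑ i, x i ^ 2 := by rw [← Finset.mul_sum, mul_assoc]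
      _ ≤ _ := mul_le_mul_of_nonneg_left hQ (mul_nonneg hM0 hR0)
  · calc _ ≤ ∑ j, M * ∑ i, (B i j + P i j) * |x i| :=
          Finset.sum_le_sum fun j _ => mul_le_mul (hM j)
            (abs_dev_le (fun j i => h.left_nonneg i j) (fun j i => h.right_nonneg i j) x j)
            (abs_nonneg _) hM0
      _ = M * ∑ i, ((∑ j, B i j) + ∑ j, P i j) * |x i| := by
          rw [← Finset.mul_sum, Finset.sum_comm]
          simp_rw [← Finset.sum_mul, Finset.sum_add_distrib]
      _ ≤ M * ∑ i, 3 * R * |x i| := by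
          refine mul_le_mul_of_nonneg_left (Finset.sum_le_sum fun i _ => ?_) hM0
          refine mul_le_mul_of_nonneg_right ?_ (abs_nonneg _)
          linarith [hR i, h.row_le ht ha hR i]
      _ = M * (3 * R * ∑ i, |x i|) := by rw [← Finset.mul_sum]
      _ ≤ _ := by gcongr

end Close

section Close

variable {B P : ι → κ → ℝ} {a b t : ℝ} (h : DegreesClose B P a b t)
include h

/-- Effect on the entries of a firm vector of replacing inverse degrees by inverse mean degrees. -/
lemma DegreesClose.col_mul_sq_le (hb : 0 < b) (ht : 0 ≤ t) (w : ℝ) (j : κ) :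
    (∑ i, B i j) * (w / ((∑ i, B i j) + b) - w / ((∑ i, P i j) + b)) ^ 2
      ≤ t ^ 2 * (w ^ 2 / ((∑ i, B i j) + b)) := by
  have hD := col_add_pos h.left_nonneg hb j
  have hE := col_add_pos h.right_nonneg hb j
  have hc := h.col j
  set D := (∑ i, B i j) + b with hDdef
  set E := (∑ i, P i j) + b with hEdef
  have e1 : w / D - w / E = w * ((E - D) / E) / D := by field_simp
  have h1 : ((E - D) / E) ^ 2 ≤ t ^ 2 := by
    rw [sq_le_sq, abs_of_nonneg ht, abs_div, abs_of_pos hE, div_le_iff₀ hE, abs_sub_comm]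
    have e : D - E = ∑ i, B i j - ∑ i, P i j := by rw [hDdef, hEdef]; ring
    rwa [e]
  calc (∑ i, B i j) * (w / D - w / E) ^ 2 ≤ D * (w / D - w / E) ^ 2 :=
        mul_le_mul_of_nonneg_right (by linarith) (sq_nonneg _)
    _ = ((E - D) / E) ^ 2 * (w ^ 2 / D) := by rw [e1]; field_simp
    _ ≤ _ := mul_le_mul_of_nonneg_right h1 (by positivity)

lemma DegreesClose.div_col_le (hb : 0 < b) (w : ℝ) (hw : 0 ≤ w) (j : κ) :
    w / ((∑ i, B i j) + b) ≤ 9 * (((∑ i, P i j) + b)⁻¹ * w) := by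
  have hD := col_add_pos h.left_nonneg hb j
  have hE := col_add_pos h.right_nonneg hb j
  have := h.col_lower j
  rw [div_le_iff₀ hD, ← div_eq_inv_mul, ← mul_div_assoc, div_mul_eq_mul_div, le_div_iff₀ hE]
  nlinarith

/-- The Laplacian of a network with close degrees and small deviations is close, on a given
vector, to that of the mean network. -/
lemma DegreesClose.nrm_lap_sub_le (ha : 0 < a) (hb : 0 < b) (ht0 : 0 ≤ t) (ht : t ≤ 1)
    {x : ι → ℝ} {l A T M R q : ℝ} (hl : 0 ≤ l) (hA0 : 0 ≤ A) (hq : 0 ≤ q)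
    (hM0 : 0 ≤ M) (hM : ∀ j, ((∑ i, P i j) + b)⁻¹ ≤ M) (hR : ∀ i, (∑ j, P i j) + a ≤ R)
    (hR0 : 0 ≤ R) (hMR : 1 ≤ M * R) (hlM : 3 * M * l = t ^ 2)
    (hA : ∀ i, |x i| ≤ A) (hT : ∑ i, |x i| ≤ T) (hAT : A * T ≤ q ^ 2)
    (hcol : BernsteinRows (fun j i => B i j) (fun j i => P i j) l A x)
    (hrow : BernsteinRows B P l A fun j => (∑ i, P i j * x i) / ((∑ i, P i j) + b)) :
    nrm (fun i => lap B a b x i - lap P a b x i) ≤ 16 * t * R * q := by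
  have hB := h.left_nonneg
  have hP := h.right_nonneg
  have hD := col_add_pos hB hb
  have hE := col_add_pos hP hb
  have hBR : ∀ i, ∑ j, B i j ≤ 2 * R := h.row_le ht ha hR
  have hPR : ∀ i, ∑ j, P i j ≤ R := fun i => by linarith [hR i]
  have hQ : ∑ i, x i ^ 2 ≤ q ^ 2 := (sum_sq_le_of_abs_le hA hA0 hT).trans hAT
  have htRq : 0 ≤ t * R * q := by positivity
  set y : κ → ℝ := dev (fun j i => B i j) (fun j i => P i j) x with hy
  set w : κ → ℝ := fun j => ∑ i, P i j * x i with hw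
  have hwsum : ∑ j, ((∑ i, P i j) + b)⁻¹ * w j ^ 2 ≤ R * q ^ 2 := by
    calc _ ≤ ∑ j, ∑ i, P i j * x i ^ 2 := by
          refine Finset.sum_le_sum fun j _ => ?_
          have hs : 0 ≤ ∑ i, P i j * x i ^ 2 :=
            Finset.sum_nonneg fun i _ => mul_nonneg (hP i j) (sq_nonneg _)
          rw [← div_eq_inv_mul]
          refine le_trans ?_ (mul_div_col_le hP hb (j := j) hs)
          rw [← mul_div_assoc]
          exact div_le_div_of_nonneg_right (sq_sum_mul_le (fun i => hP i j) x) (hE j).le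
      _ = ∑ i, (∑ j, P i j) * x i ^ 2 := by rw [Finset.sum_comm]; simp_rw [Finset.sum_mul]
      _ ≤ ∑ i, R * x i ^ 2 :=
          Finset.sum_le_sum fun i _ => mul_le_mul_of_nonneg_right (hPR i) (sq_nonneg _)
      _ = R * ∑ i, x i ^ 2 := by rw [Finset.mul_sum]
      _ ≤ _ := mul_le_mul_of_nonneg_left hQ hR0
  -- The four pieces cost `1 + 8 + 5 + 2 = 16` units of `t * R * q`; the last three come from
  -- `2·9·10/3 = 60 ≤ 8²`, `2·9 = 18 ≤ 5²` and `10/3 ≤ 2²`.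
  have n1 : nrm (fun i => ((∑ j, B i j) - ∑ j, P i j) * x i) ≤ t * R * q := by
    refine nrm_le htRq ?_
    calc _ ≤ ∑ i, (t * R) ^ 2 * x i ^ 2 := by
          refine Finset.sum_le_sum fun i _ => ?_
          rw [mul_pow]
          refine mul_le_mul_of_nonneg_right ?_ (sq_nonneg _)
          rw [sq_le_sq, abs_of_nonneg (mul_nonneg ht0 hR0)]
          exact (h.row i).trans (mul_le_mul_of_nonneg_left (hR i) ht0)
      _ = (t * R) ^ 2 * ∑ i, x i ^ 2 := by rw [Finset.mul_sum]
      _ ≤ (t * R) ^ 2 * q ^ 2 := mul_le_mul_of_nonneg_left hQ (sq_nonneg _)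
      _ = _ := by ring
  have n2 : nrm (fun i => ∑ j, B i j * (y j / ((∑ i, B i j) + b))) ≤ 8 * (t * R * q) := by
    have hys : ∑ j, ((∑ i, P i j) + b)⁻¹ * y j ^ 2 ≤ 10 / 3 * (t ^ 2 * R * q ^ 2) := by
      refine h.sum_sq_colDev_le ht ha hb hl hA0 hcol hM0 hM hR hR0 hQ hT ?_ ?_
      · rw [← hlM]; apply le_of_eq; ring
      · calc l * A * (M * (3 * R * T)) = 3 * M * l * R * (A * T) := by ring
          _ ≤ 3 * M * l * R * q ^ 2 := mul_le_mul_of_nonneg_left hAT (by positivity)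
          _ = _ := by rw [hlM]
    refine nrm_le (by positivity) ((sum_sq_sum_mul_le hB hBR _).trans ?_)
    calc _ ≤ 2 * R * ∑ j, 9 * (((∑ i, P i j) + b)⁻¹ * y j ^ 2) := by
          refine mul_le_mul_of_nonneg_left (Finset.sum_le_sum fun j _ => ?_) (by positivity)
          refine le_trans ?_ (h.div_col_le hb _ (sq_nonneg (y j)) j)
          calc _ ≤ ((∑ i, B i j) + b) * (y j / ((∑ i, B i j) + b)) ^ 2 :=
                mul_le_mul_of_nonneg_right (by linarith) (sq_nonneg _)
            _ = _ := by have := (hD j).ne'; field_simp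
      _ = 18 * R * ∑ j, ((∑ i, P i j) + b)⁻¹ * y j ^ 2 := by rw [← Finset.mul_sum]; ring
      _ ≤ 18 * R * (10 / 3 * (t ^ 2 * R * q ^ 2)) := mul_le_mul_of_nonneg_left hys (by positivity)
      _ ≤ _ := by nlinarith [sq_nonneg (t * R * q)]
  have n3 : nrm (fun i => ∑ j, B i j * (w j / ((∑ i, B i j) + b) - w j / ((∑ i, P i j) + b)))
      ≤ 5 * (t * R * q) := by
    refine nrm_le (by positivity) ((sum_sq_sum_mul_le hB hBR _).trans ?_)
    calc _ ≤ 2 * R * ∑ j, t ^ 2 * (9 * (((∑ i, P i j) + b)⁻¹ * w j ^ 2)) := by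
          refine mul_le_mul_of_nonneg_left (Finset.sum_le_sum fun j _ => ?_) (by positivity)
          exact (h.col_mul_sq_le hb ht0 (w j) j).trans
            (mul_le_mul_of_nonneg_left (h.div_col_le hb _ (sq_nonneg _) j) (sq_nonneg _))
      _ = 18 * R * t ^ 2 * ∑ j, ((∑ i, P i j) + b)⁻¹ * w j ^ 2 := by
          rw [← Finset.mul_sum, ← Finset.mul_sum]; ring
      _ ≤ 18 * R * t ^ 2 * (R * q ^ 2) := mul_le_mul_of_nonneg_left hwsum (by positivity)
      _ ≤ _ := by nlinarith [sq_nonneg (t * R * q)]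
  have n4 : nrm (dev B P fun j => w j / ((∑ i, P i j) + b)) ≤ 2 * (t * R * q) := by
    refine nrm_le (by positivity) ?_
    have := h.sum_sq_dev_le ht hb hl hA0 hrow (v := R * q ^ 2) (T := R * T)
      (s := t ^ 2 * R ^ 2 * q ^ 2) ?_ ?_ ?_ ?_
    · nlinarith [sq_nonneg (t * R * q)]
    · refine le_of_eq_of_le (Finset.sum_congr rfl fun j _ => ?_) hwsum
      have := (hE j).ne'
      field_simp
      rfl
    · calc _ = ∑ j, |w j| := by
            refine Finset.sum_congr rfl fun j _ => ?_
            rw [abs_div, abs_of_pos (hE j), mul_div_cancel₀ _ (hE j).ne']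
        _ ≤ ∑ j, ∑ i, P i j * |x i| :=
            Finset.sum_le_sum fun j _ => abs_sum_mul_le (fun i => hP i j) x
        _ = ∑ i, (∑ j, P i j) * |x i| := by rw [Finset.sum_comm]; simp_rw [Finset.sum_mul]
        _ ≤ ∑ i, R * |x i| :=
            Finset.sum_le_sum fun i _ => mul_le_mul_of_nonneg_right (hPR i) (abs_nonneg _)
        _ = R * ∑ i, |x i| := by rw [Finset.mul_sum]
        _ ≤ _ := mul_le_mul_of_nonneg_left hT hR0
    -- Row deviations carry no inverse column degree, so the `M` that turns `l` into `t²` is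
    -- inserted through `1 ≤ M * R`.
    · calc l * (R * q ^ 2) ≤ l * (R * q ^ 2) * (M * R) :=
            le_mul_of_one_le_right (by positivity) hMR
        _ = _ := by rw [← hlM]; ring
    · have hT0 : 0 ≤ T := (Finset.sum_nonneg fun i _ => abs_nonneg _).trans hT
      calc l * A * (3 * (R * T)) ≤ l * A * (3 * (R * T)) * (M * R) :=
            le_mul_of_one_le_right (by positivity) hMR
        _ = 3 * M * l * R ^ 2 * (A * T) := by ring
        _ ≤ 3 * M * l * R ^ 2 * q ^ 2 := mul_le_mul_of_nonneg_left hAT (by positivity)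
        _ = _ := by rw [hlM]
  -- Telescoping with `Bᵀx = y + w`, where `w = Pᵀx`: the change of row degrees, of the column sums,
  -- of the inverse column degrees, and of the last factor `B`.
  have key : (fun i => lap B a b x i - lap P a b x i) = fun i =>
      (((∑ j, B i j) - ∑ j, P i j) * x i
        - ∑ j, B i j * (y j / ((∑ i, B i j) + b)))
      - ((∑ j, B i j * (w j / ((∑ i, B i j) + b) - w j / ((∑ i, P i j) + b)))
        + dev B P (fun j => w j / ((∑ i, P i j) + b)) i) := by
    funext i
    have e : ∀ j, ∑ i', B i' j * x i' = y j + w j := fun j => by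
      rw [hy, hw, dev, ← Finset.sum_add_distrib]
      exact Finset.sum_congr rfl fun i _ => by ring
    have e2 : ∑ j, B i j * ((∑ i', B i' j * x i') / ((∑ i', B i' j) + b))
          - ∑ j, P i j * (w j / ((∑ i', P i' j) + b))
        = ∑ j, B i j * (y j / ((∑ i, B i j) + b))
          + ∑ j, B i j * (w j / ((∑ i, B i j) + b) - w j / ((∑ i, P i j) + b))
          + dev B P (fun j => w j / ((∑ i, P i j) + b)) i := by
      rw [dev, ← Finset.sum_add_distrib, ← Finset.sum_add_distrib, ← Finset.sum_sub_distrib]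
      exact Finset.sum_congr rfl fun j _ => by rw [e]; ring
    rw [lap, lap]
    linear_combination -e2
  rw [key]
  have := nrm_sub_le
    (fun i => ((∑ j, B i j) - ∑ j, P i j) * x i - ∑ j, B i j * (y j / ((∑ i, B i j) + b)))
    (fun i => (∑ j, B i j * (w j / ((∑ i, B i j) + b) - w j / ((∑ i, P i j) + b)))
        + dev B P (fun j => w j / ((∑ i, P i j) + b)) i)
  have m1 := nrm_sub_le (fun i => ((∑ j, B i j) - ∑ j, P i j) * x i)
    (fun i => ∑ j, B i j * (y j / ((∑ i, B i j) + b)))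
  have m2 := nrm_add_le
    (fun i => ∑ j, B i j * (w j / ((∑ i, B i j) + b) - w j / ((∑ i, P i j) + b)))
    (dev B P (fun j => w j / ((∑ i, P i j) + b)))
  linarith

/-- Comparison of the transfers of a firm vector along a network and along the mean network. -/
lemma DegreesClose.nrm_transfer_sub_le (ha : 0 < a) (hb : 0 < b) (ht0 : 0 ≤ t) (ht : t ≤ 1)
    {v : κ → ℝ} {l φ M R : ℝ} (hl : 0 ≤ l) (hφ : 0 ≤ φ)
    (hM0 : 0 ≤ M) (hM : ∀ j, ((∑ i, P i j) + b)⁻¹ ≤ M) (hR : ∀ i, (∑ j, P i j) + a ≤ R)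
    (hR0 : 0 ≤ R) (hlM : 3 * M * l = t ^ 2) (hv : ∀ j, |v j| ≤ φ)
    (hrow : BernsteinRows B P l (M * φ) fun j => v j / ((∑ i, P i j) + b)) :
    nrm (fun i => transfer B b v i - transfer P b v i)
      ≤ (2 + 2 * √(R / b)) * (t * √(Fintype.card κ : ℝ) * φ) := by
  have hB := h.left_nonneg
  have hP := h.right_nonneg
  have hD := col_add_pos hB hb
  have hE := col_add_pos hP hb
  have hBR : ∀ i, ∑ j, B i j ≤ 2 * R := h.row_le ht ha hR
  have hv2 : ∀ j, v j ^ 2 ≤ φ ^ 2 := fun j => by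
    rw [sq_le_sq, abs_of_nonneg hφ]; exact hv j
  set N : ℝ := (Fintype.card κ : ℝ) with hN
  have hN0 : 0 ≤ N := Nat.cast_nonneg _
  have n1 : nrm (fun i => ∑ j, B i j * (v j / ((∑ i, B i j) + b) - v j / ((∑ i, P i j) + b)))
      ≤ 2 * √(R / b) * (t * √N * φ) := by
    refine nrm_le (by positivity) ((sum_sq_sum_mul_le hB hBR _).trans ?_)
    calc _ ≤ 2 * R * ∑ _j : κ, t ^ 2 * (φ ^ 2 / b) := by
          refine mul_le_mul_of_nonneg_left (Finset.sum_le_sum fun j _ => ?_) (by positivity)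
          refine (h.col_mul_sq_le hb ht0 (v j) j).trans ?_
          refine mul_le_mul_of_nonneg_left ?_ (sq_nonneg _)
          -- The realized column degree is bounded below only by `b` here, which is the origin of
          -- `√(R / b)`.
          exact div_le_div₀ (sq_nonneg _) (hv2 j) hb
            (le_add_of_nonneg_left (Finset.sum_nonneg fun i _ => hB i j))
      _ = 2 * (R / b) * (t ^ 2 * N * φ ^ 2) := by simp [hN]; ring
      _ ≤ 4 * (R / b) * (t ^ 2 * N * φ ^ 2) := by
          refine mul_le_mul_of_nonneg_right ?_ (by positivity)
          have : 0 ≤ R / b := by positivity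
          linarith
      _ = _ := by
          rw [mul_pow, mul_pow, mul_pow, mul_pow, Real.sq_sqrt (by positivity), Real.sq_sqrt hN0]
          ring
  have n2 : nrm (dev B P fun j => v j / ((∑ i, P i j) + b)) ≤ 2 * (t * √N * φ) := by
    refine nrm_le (by positivity) ?_
    have := h.sum_sq_dev_le ht hb hl (by positivity) hrow (v := M * (N * φ ^ 2)) (T := N * φ)
      (s := t ^ 2 * N * φ ^ 2) ?_ ?_ ?_ ?_
    · rw [mul_pow, mul_pow, mul_pow, Real.sq_sqrt hN0]
      have : 0 ≤ t ^ 2 * N * φ ^ 2 := by positivity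
      linarith
    · calc _ ≤ ∑ _j : κ, M * φ ^ 2 := by
            refine Finset.sum_le_sum fun j _ => ?_
            have e : ((∑ i, P i j) + b) * (v j / ((∑ i, P i j) + b)) ^ 2
                = ((∑ i, P i j) + b)⁻¹ * v j ^ 2 := by
              have := (hE j).ne'
              field_simp
            rw [e]
            exact mul_le_mul (hM j) (hv2 j) (sq_nonneg _) hM0
        _ = _ := by simp [hN]; ring
    · calc _ = ∑ j, |v j| := by
            refine Finset.sum_congr rfl fun j _ => ?_
            rw [abs_div, abs_of_pos (hE j), mul_div_cancel₀ _ (hE j).ne']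
        _ ≤ ∑ _j : κ, φ := Finset.sum_le_sum fun j _ => hv j
        _ = _ := by simp [hN]
    · rw [← hlM]; apply le_of_eq; ring
    · rw [← hlM]; apply le_of_eq; ring
  have key : (fun i => transfer B b v i - transfer P b v i) = fun i =>
      (∑ j, B i j * (v j / ((∑ i, B i j) + b) - v j / ((∑ i, P i j) + b)))
        + dev B P (fun j => v j / ((∑ i, P i j) + b)) i := by
    funext i
    rw [transfer, transfer, dev, ← Finset.sum_add_distrib, ← Finset.sum_sub_distrib]
    exact Finset.sum_congr rfl fun j _ => by ring
  rw [key]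
  have := nrm_add_le
    (fun i => ∑ j, B i j * (v j / ((∑ i, B i j) + b) - v j / ((∑ i, P i j) + b)))
    (dev B P (fun j => v j / ((∑ i, P i j) + b)))
  linarith

end Close

lemma lap_sub (B : ι → κ → ℝ) (a b : ℝ) (x y : ι → ℝ) (i : ι) :
    lap B a b (fun i => x i - y i) i = lap B a b x i - lap B a b y i := by
  simp only [lap, mul_sub, Finset.sum_sub_distrib, sub_div]
  ring

lemma lap_add (B : ι → κ → ℝ) (a b : ℝ) (x y : ι → ℝ) (i : ι) :
    lap B a b (fun i => x i + y i) i = lap B a b x i + lap B a b y i := by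
  simp only [lap, mul_add, Finset.sum_add_distrib, add_div]
  ring

/-! ### Sup and `ℓ¹` bounds for the two parts of the mean bias -/

section MeanBias

variable {P : ι → κ → ℝ} (hP : ∀ i j, 0 ≤ P i j) {a b : ℝ} (ha : 0 < a) (hb : 0 < b)
include hP ha hb

lemma abs_workerPart_le {x m : ι → ℝ} {μ : ℝ} (hx : ∀ i, lap P a b x i = -(a * m i))
    (hm : ∀ i, |m i| ≤ μ) (i : ι) : |x i| ≤ μ := by
  have := abs_le_of_abs_lap_le hP hb ha (x := x) (A := a * μ) (fun i => ?_) i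
  · rwa [mul_div_cancel_left₀ _ ha.ne'] at this
  · rw [hx, abs_neg, abs_mul, abs_of_pos ha]
    exact mul_le_mul_of_nonneg_left (hm i) ha.le

lemma sum_abs_workerPart_le {x m : ι → ℝ} {μ : ℝ} (hx : ∀ i, lap P a b x i = -(a * m i))
    (hm : ∀ i, |m i| ≤ μ) : ∑ i, |x i| ≤ Fintype.card ι * μ := by
  refine le_of_mul_le_mul_left ?_ ha
  refine (sum_abs_le_sum_abs_lap hP hb ha x).trans ?_
  calc _ ≤ ∑ _i : ι, a * μ := by
        refine Finset.sum_le_sum fun i _ => ?_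
        rw [hx, abs_neg, abs_mul, abs_of_pos ha]
        exact mul_le_mul_of_nonneg_left (hm i) ha.le
    _ = _ := by simp; ring

lemma abs_firmPart_le {x : ι → ℝ} {v : κ → ℝ} {φ r R : ℝ}
    (hx : ∀ i, lap P a b x i = b * transfer P b v i) (hv : ∀ j, |v j| ≤ φ) (hφ : 0 ≤ φ)
    (hr0 : 0 ≤ r) (hr : ∀ j, ((∑ i, P i j) + b)⁻¹ ≤ r) (hR : ∀ i, ∑ j, P i j ≤ R) (i : ι) :
    |x i| ≤ b / a * (R * r * φ) := by
  have := abs_le_of_abs_lap_le hP hb ha (x := x) (A := b * (R * r * φ)) (fun i => ?_) i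
  · rwa [mul_div_right_comm] at this
  · rw [hx, abs_mul, abs_of_pos hb]
    exact mul_le_mul_of_nonneg_left (abs_transfer_le hP hb hv hφ hr0 hr hR i) hb.le

/-- The degree ratio `R * r` enters the sup bound but not this `ℓ¹` bound, so the Euclidean size of
the firm part carries only `√(R * r)`. -/
lemma sum_abs_firmPart_le {x : ι → ℝ} {v : κ → ℝ} {φ : ℝ}
    (hx : ∀ i, lap P a b x i = b * transfer P b v i) (hv : ∀ j, |v j| ≤ φ) :
    ∑ i, |x i| ≤ b / a * (Fintype.card κ * φ) := by
  refine le_of_mul_le_mul_left ?_ ha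
  refine (sum_abs_le_sum_abs_lap hP hb ha x).trans ?_
  calc _ = b * ∑ i, |transfer P b v i| := by
        rw [Finset.mul_sum]
        exact Finset.sum_congr rfl fun i _ => by rw [hx, abs_mul, abs_of_pos hb]
    _ ≤ b * (Fintype.card κ * φ) :=
        mul_le_mul_of_nonneg_left (sum_abs_transfer_le hP hb hv) hb.le
    _ = _ := by field_simp

omit ha in
lemma abs_average_le {x : ι → ℝ} {A : ℝ} (hx : ∀ i, |x i| ≤ A) (hA : 0 ≤ A) (j : κ) :
    |(∑ i, P i j * x i) / ((∑ i, P i j) + b)| ≤ A := by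
  rw [abs_div, abs_of_pos (col_add_pos hP hb j)]
  refine le_trans ?_ (mul_div_col_le hP hb (j := j) hA)
  rw [← mul_div_assoc]
  refine div_le_div_of_nonneg_right ?_ (col_add_pos hP hb j).le
  refine (abs_sum_mul_le (fun i => hP i j) _).trans ?_
  rw [Finset.sum_mul]
  exact Finset.sum_le_sum fun i _ => mul_le_mul_of_nonneg_left (hx i) (hP i j)

end MeanBias

/-- Distance between the bias vector on a network and the one on the mean network, when degrees
are close and the deviations obey Bernstein-type bounds along the five relevant vectors. -/
theorem DegreesClose.nrm_bias_sub_le {B P : ι → κ → ℝ} {a b t : ℝ} (h : DegreesClose B P a b t)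
    (ha : 0 < a) (hb : 0 < b) (ht0 : 0 ≤ t) (ht : t ≤ 1)
    {m x x₁ x₂ : ι → ℝ} {v : κ → ℝ} {l M r R μ φ : ℝ} (hl : 0 ≤ l) (hμ : 0 ≤ μ) (hφ : 0 ≤ φ)
    (hr0 : 0 ≤ r) (hr : ∀ j, ((∑ i, P i j) + b)⁻¹ ≤ r) (hrM : r ≤ M)
    (hR : ∀ i, (∑ j, P i j) + a ≤ R) (hR0 : 0 ≤ R) (hMR : 1 ≤ M * R) (hlM : 3 * M * l = t ^ 2)
    (hm : ∀ i, |m i| ≤ μ) (hv : ∀ j, |v j| ≤ φ)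
    (hx : ∀ i, lap B a b x i = -(a * m i) + b * transfer B b v i)
    (hx₁ : ∀ i, lap P a b x₁ i = -(a * m i)) (hx₂ : ∀ i, lap P a b x₂ i = b * transfer P b v i)
    (hcol₁ : BernsteinRows (fun j i => B i j) (fun j i => P i j) l μ x₁)
    (hrow₁ : BernsteinRows B P l μ fun j => (∑ i, P i j * x₁ i) / ((∑ i, P i j) + b))
    (hcol₂ : BernsteinRows (fun j i => B i j) (fun j i => P i j) l (b / a * (R * r * φ)) x₂)
    (hrow₂ : BernsteinRows B P l (b / a * (R * r * φ))
      fun j => (∑ i, P i j * x₂ i) / ((∑ i, P i j) + b))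
    (hrow : BernsteinRows B P l (M * φ) fun j => v j / ((∑ i, P i j) + b)) :
    a * nrm (fun i => x i - (x₁ i + x₂ i)) ≤
      16 * t * R * (√(Fintype.card ι : ℝ) * μ + b / a * √(R * r) * √(Fintype.card κ : ℝ) * φ)
        + b * ((2 + 2 * √(R / b)) * (t * √(Fintype.card κ : ℝ) * φ)) := by
  have hP := h.right_nonneg
  have hM0 := hr0.trans hrM
  have hrM' := fun j => (hr j).trans hrM
  have hPR : ∀ i, ∑ j, P i j ≤ R := fun i => by linarith [hR i]
  have k₁ := h.nrm_lap_sub_le ha hb ht0 ht hl hμ (q := √(Fintype.card ι : ℝ) * μ) (by positivity)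
    hM0 hrM' hR hR0 hMR hlM (abs_workerPart_le hP ha hb hx₁ hm)
    (sum_abs_workerPart_le hP ha hb hx₁ hm)
    (by rw [mul_pow, Real.sq_sqrt (Nat.cast_nonneg _)]; apply le_of_eq; ring) hcol₁ hrow₁
  have k₂ := h.nrm_lap_sub_le ha hb ht0 ht hl (A := b / a * (R * r * φ)) (by positivity)
    (q := b / a * √(R * r) * √(Fintype.card κ : ℝ) * φ) (by positivity)
    hM0 hrM' hR hR0 hMR hlM (abs_firmPart_le hP ha hb hx₂ hv hφ hr0 hr hPR)
    (sum_abs_firmPart_le hP ha hb hx₂ hv)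
    (by
      rw [mul_pow, mul_pow, mul_pow, Real.sq_sqrt (Nat.cast_nonneg _),
        Real.sq_sqrt (by positivity)]
      apply le_of_eq; ring) hcol₂ hrow₂
  have k₃ := h.nrm_transfer_sub_le ha hb ht0 ht hl hφ hM0 hrM' hR hR0 hlM hv hrow
  have e : lap B a b (fun i => x i - (x₁ i + x₂ i)) = fun i =>
      b * (transfer B b v i - transfer P b v i)
        - ((lap B a b x₁ i - lap P a b x₁ i) + (lap B a b x₂ i - lap P a b x₂ i)) := by
    funext i
    rw [lap_sub, lap_add, hx, hx₁, hx₂]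
    ring
  refine (nrm_le_nrm_lap h.left_nonneg hb _).trans ?_
  rw [e]
  have s₁ := nrm_sub_le (fun i => b * (transfer B b v i - transfer P b v i)) (fun i =>
    (lap B a b x₁ i - lap P a b x₁ i) + (lap B a b x₂ i - lap P a b x₂ i))
  have s₂ := nrm_add_le (fun i => lap B a b x₁ i - lap P a b x₁ i)
    (fun i => lap B a b x₂ i - lap P a b x₂ i)
  have s₃ := nrm_mul b (fun i => transfer B b v i - transfer P b v i)
  rw [abs_of_pos hb] at s₃
  have s₄ := mul_le_mul_of_nonneg_left k₃ hb.le
  linarith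

end Deterministic

/-! ### Tail bounds for weighted sums of independent Bernoulli variables -/

section Tails

variable {Ω σ : Type*} [MeasurableSpace Ω] [Fintype σ]

/-- Centered weighted sum of Bernoulli variables with success probabilities `q`. -/
def bsum (X : σ → Ω → Bool) (q c : σ → ℝ) (ω : Ω) : ℝ :=
  ∑ s, ((if X s ω = true then 1 else 0) - q s) * c s

variable {P : Measure Ω} [IsProbabilityMeasure P] {X : σ → Ω → Bool} {q : σ → ℝ}
  (hX : ∀ s, Measurable (X s)) (hind : iIndepFun X P)
  (hlaw : ∀ s, P {ω | X s ω = true} = ENNReal.ofReal (q s)) (hq : ∀ s, 0 ≤ q s)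
include hX hind hlaw hq

-- Comparison with the centered Poisson law: `1 + z ≤ exp z` with `z = q (exp (τc) - 1)`.
omit hind [Fintype σ] in
lemma mgf_bernoulli_le (c : ℝ) (s : σ) (τ : ℝ) :
    mgf (fun ω => ((if X s ω = true then 1 else 0) - q s) * c) P τ
      ≤ Real.exp (q s * (Real.exp (τ * c) - 1 - τ * c)) := by
  have hset : MeasurableSet {ω | X s ω = true} := hX s (measurableSet_singleton true)
  have hreal : P.real {ω | X s ω = true} = q s := by
    rw [measureReal_def, hlaw, ENNReal.toReal_ofReal (hq s)]
  have e : (fun ω => Real.exp (τ * (((if X s ω = true then (1 : ℝ) else 0) - q s) * c)))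
      = fun ω => Real.exp (-(q s * (τ * c))) *
        (1 + (Real.exp (τ * c) - 1) * {ω | X s ω = true}.indicator (fun _ => (1 : ℝ)) ω) := by
    funext ω
    by_cases hω : X s ω = true
    · simp only [hω, if_true, Set.indicator, Set.mem_ofPred_eq, mul_one, add_sub_cancel]
      rw [← Real.exp_add]; congr 1; ring
    · simp only [hω, Set.indicator, Set.mem_ofPred_eq]
      norm_num; ring
  have hi : Integrable ({ω | X s ω = true}.indicator fun _ => (1 : ℝ)) P :=
    (integrable_const 1).indicator hset
  rw [mgf, e, integral_const_mul, integral_add (integrable_const _) (hi.const_mul _),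
    integral_const_mul, integral_indicator_const _ hset, hreal]
  simp only [integral_const, probReal_univ, smul_eq_mul, mul_one]
  have := Real.add_one_le_exp (q s * (Real.exp (τ * c) - 1))
  calc _ ≤ Real.exp (-(q s * (τ * c))) * Real.exp (q s * (Real.exp (τ * c) - 1)) :=
        mul_le_mul_of_nonneg_left (by linarith) (Real.exp_pos _).le
    _ = _ := by rw [← Real.exp_add]; congr 1; ring

lemma measureReal_bsum_gt_le (c : σ → ℝ) {τ : ℝ} (hτ : 0 ≤ τ) (r : ℝ) :
    P.real {ω | r < bsum X q c ω}
      ≤ Real.exp ((∑ s, q s * (Real.exp (τ * c s) - 1 - τ * c s)) - τ * r) := by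
  set Y : σ → Ω → ℝ := fun s ω => ((if X s ω = true then 1 else 0) - q s) * c s with hY
  have hg : ∀ s, Measurable fun x : Bool => ((if x = true then (1 : ℝ) else 0) - q s) * c s :=
    fun s => Measurable.of_discrete
  have hYm : ∀ s, Measurable (Y s) := fun s => (hg s).comp (hX s)
  have hYind : iIndepFun Y P := hind.comp _ hg
  have hS : bsum X q c = ∑ s, Y s := by funext ω; simp [bsum, hY]
  have hbd : ∀ ω, bsum X q c ω ≤ ∑ s, (1 + q s) * |c s| := by
    intro ω
    refine Finset.sum_le_sum fun s _ => (le_abs_self _).trans ?_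
    rw [abs_mul]
    refine mul_le_mul_of_nonneg_right ?_ (abs_nonneg _)
    have := hq s
    split_ifs <;> exact abs_le.2 ⟨by linarith, by linarith⟩
  have hSm : Measurable (bsum X q c) := by
    have e : bsum X q c = fun ω => ∑ s, Y s ω := rfl
    rw [e]; exact Finset.measurable_sum _ fun s _ => hYm s
  have hint : Integrable (fun ω => Real.exp (τ * bsum X q c ω)) P := by
    refine Integrable.of_bound (C := Real.exp (τ * ∑ s, (1 + q s) * |c s|))
      (Real.measurable_exp.comp (hSm.const_mul τ)).aestronglyMeasurable
      (Filter.Eventually.of_forall fun ω => ?_)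
    rw [Real.norm_eq_abs, Real.abs_exp]
    exact Real.exp_le_exp.2 (mul_le_mul_of_nonneg_left (hbd ω) hτ)
  calc P.real {ω | r < bsum X q c ω} ≤ P.real {ω | r ≤ bsum X q c ω} :=
        measureReal_mono fun ω (hω : r < _) => hω.le
    _ ≤ Real.exp (-τ * r) * mgf (bsum X q c) P τ := measure_ge_le_exp_mul_mgf r hτ hint
    _ ≤ Real.exp (-τ * r) * ∏ s, Real.exp (q s * (Real.exp (τ * c s) - 1 - τ * c s)) := by
        rw [hS, hYind.mgf_sum hYm]
        exact mul_le_mul_of_nonneg_left (Finset.prod_le_prod (fun s _ => mgf_nonneg)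
          fun s _ => mgf_bernoulli_le hX hlaw hq (c s) s τ) (Real.exp_pos _).le
    _ = _ := by rw [← Real.exp_sum, ← Real.exp_add]; congr 1; ring

omit hX hind hlaw hq [IsProbabilityMeasure P] [MeasurableSpace Ω] in
lemma bsum_neg (c : σ → ℝ) (ω : Ω) : bsum X q (fun s => -c s) ω = -bsum X q c ω := by
  simp [bsum]

/-- Exponential Markov with `exp z - 1 - z ≤ z²` for `|z| ≤ 1`, so `τ` must satisfy `τ * A ≤ 1`. -/
lemma measureReal_bernstein_upper {c : σ → ℝ} {A l : ℝ} (hA : 0 < A) (hc : ∀ s, |c s| ≤ A)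
    (hl : 0 < l) :
    P.real {ω | 2 * √(l * ∑ s, q s * c s ^ 2) + l * A < bsum X q c ω} ≤ Real.exp (-l) := by
  set V := ∑ s, q s * c s ^ 2 with hV
  have hV0 : 0 ≤ V := Finset.sum_nonneg fun s _ => mul_nonneg (hq s) (sq_nonneg _)
  set u := √(l * V) with hu
  have hu0 : 0 ≤ u := Real.sqrt_nonneg _
  have hu2 : u ^ 2 = l * V := Real.sq_sqrt (by positivity)
  have main : ∀ τ, 0 ≤ τ → τ * A ≤ 1 → V * τ ^ 2 - τ * (2 * u + l * A) ≤ -l →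
      P.real {ω | 2 * u + l * A < bsum X q c ω} ≤ Real.exp (-l) := by
    intro τ hτ hτA hle
    refine (measureReal_bsum_gt_le hX hind hlaw hq c hτ _).trans (Real.exp_le_exp.2 ?_)
    refine le_trans (sub_le_sub_right ?_ _) hle
    rw [hV, Finset.sum_mul]
    refine Finset.sum_le_sum fun s _ => ?_
    rw [mul_assoc]
    refine mul_le_mul_of_nonneg_left ?_ (hq s)
    have h1 : |τ * c s| ≤ 1 := by
      rw [abs_mul, abs_of_nonneg hτ]
      exact (mul_le_mul_of_nonneg_left (hc s) hτ).trans hτA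
    refine (le_abs_self _).trans ((Real.abs_exp_sub_one_sub_id_le h1).trans_eq (by ring))
  -- The optimal `τ = √(l / V) = u / V` is admissible only for large variance; for small variance
  -- the endpoint `τ = 1 / A` is enough.
  rcases le_or_gt V (A ^ 2 * l) with hcase | hcase
  · have hVu : V ≤ A * u := by
      refine le_of_sq_le_sq ?_ (by positivity)
      rw [mul_pow, hu2]
      nlinarith
    refine main A⁻¹ (by positivity) (by rw [inv_mul_cancel₀ hA.ne']) ?_
    have e : V * A⁻¹ ^ 2 - A⁻¹ * (2 * u + l * A) = (V - 2 * (A * u)) / A ^ 2 - l := by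
      field_simp
      ring
    rw [e]
    have : (V - 2 * (A * u)) / A ^ 2 ≤ 0 :=
      div_nonpos_of_nonpos_of_nonneg (by nlinarith [mul_nonneg hA.le hu0]) (sq_nonneg _)
    linarith
  · have hVpos : 0 < V := lt_trans (by positivity) hcase
    refine main (u / V) (by positivity) ?_ ?_
    · rw [div_mul_eq_mul_div, div_le_one hVpos]
      refine le_of_sq_le_sq ?_ hV0
      rw [mul_pow, hu2]
      nlinarith
    · have e : V * (u / V) ^ 2 - u / V * (2 * u + l * A) = -(u ^ 2 / V) - u / V * (l * A) := by
        field_simp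
        ring
      have e2 : u ^ 2 / V = l := by rw [hu2]; field_simp
      have : 0 ≤ u / V * (l * A) := by positivity
      rw [e, e2]
      linarith

/-- Bernstein's inequality, in square-root free form. -/
lemma measureReal_bernstein {c : σ → ℝ} {A l : ℝ} (hA : 0 ≤ A) (hc : ∀ s, |c s| ≤ A)
    (hl : 0 < l) :
    P.real {ω | ¬ bsum X q c ω ^ 2 ≤ 4 * l * (∑ s, q s * c s ^ 2) + 2 * l * A * |bsum X q c ω|}
      ≤ 2 * Real.exp (-l) := by
  rcases hA.eq_or_lt with rfl | hA
  · have h0 : ∀ s, c s = 0 := fun s => abs_nonpos_iff.1 (hc s)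
    simp [bsum, h0, (Real.exp_pos _).le]
  have h1 := measureReal_bernstein_upper hX hind hlaw hq hA hc hl
  have h2 := measureReal_bernstein_upper hX hind hlaw hq (c := fun s => -c s) hA
    (fun s => by rw [abs_neg]; exact hc s) hl
  simp_rw [bsum_neg, neg_sq] at h2
  rw [two_mul (Real.exp (-l))]
  refine le_trans (measureReal_mono (fun ω hω => ?_) (measure_ne_top P _)) ((measureReal_union_le _ _).trans
    (add_le_add h1 h2))
  by_contra hcon
  simp only [Set.mem_union, Set.mem_ofPred_eq, not_or, not_lt] at hcon
  apply hω
  set V := ∑ s, q s * c s ^ 2 with hV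
  have hV0 : 0 ≤ V := Finset.sum_nonneg fun s _ => mul_nonneg (hq s) (sq_nonneg _)
  have hu2 : √(l * V) ^ 2 = l * V := Real.sq_sqrt (by positivity)
  have hy : |bsum X q c ω| ≤ 2 * √(l * V) + l * A := abs_le.2 ⟨by linarith, hcon.1⟩
  rw [← sq_abs (bsum X q c ω)]
  -- By `2u|y| ≤ y²/2 + 2u²`, the bound `y² ≤ |y| (2u + lA)` becomes `y² ≤ 4lV + 2lA|y|`.
  nlinarith [mul_le_mul_of_nonneg_left hy (abs_nonneg (bsum X q c ω)),
    sq_nonneg (|bsum X q c ω| - 2 * √(l * V))]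

/-- Chernoff bounds for regularized degrees. -/
lemma measureReal_chernoff {E l t : ℝ} (hE : 0 < E) (hqE : ∑ s, q s ≤ E) (ht0 : 0 ≤ t)
    (ht : t ≤ 1) (hl : 3 * l ≤ t ^ 2 * E) :
    P.real {ω | ¬ (bsum X q (fun _ => 1) ω ≤ t * E ∧ -(8 / 9 * t * E) ≤ bsum X q (fun _ => 1) ω)}
      ≤ 2 * Real.exp (-l) := by
  have h1 : P.real {ω | t * E < bsum X q (fun _ => 1) ω} ≤ Real.exp (-l) := by
    have h0 : 0 ≤ Real.log (1 + t) := Real.log_nonneg (by linarith)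
    refine (measureReal_bsum_gt_le hX hind hlaw hq _ h0 _).trans (Real.exp_le_exp.2 ?_)
    rw [← Finset.sum_mul, mul_one, Real.exp_log (by linarith)]
    have hlog := Real.le_log_one_add_of_nonneg ht0
    have hlog2 := Real.log_le_sub_one_of_pos (show 0 < 1 + t by linarith)
    have h3 : (∑ s, q s) * (1 + t - 1 - Real.log (1 + t)) ≤ E * (t - Real.log (1 + t)) := by
      have := mul_le_mul_of_nonneg_right hqE (show 0 ≤ t - Real.log (1 + t) by linarith)
      linarith
    -- From `log (1 + t) ≥ 2t / (t + 2)`, what remains is `t³ ≤ t²`.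
    have h4 : t + t ^ 2 / 3 ≤ (1 + t) * Real.log (1 + t) := by
      refine le_trans ?_ (mul_le_mul_of_nonneg_left hlog (by linarith))
      rw [← mul_div_assoc, le_div_iff₀ (by linarith)]
      nlinarith [mul_nonneg (sq_nonneg t) (sub_nonneg.2 ht)]
    nlinarith [mul_le_mul_of_nonneg_left h4 hE.le]
  have h2 : P.real {ω | 8 / 9 * t * E < -bsum X q (fun _ => 1) ω} ≤ Real.exp (-l) := by
    simp_rw [← bsum_neg]
    -- The threshold `8/9 * t` keeps a ninth of the mean degree even at `t = 1`, and its exponent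
    -- `32/81` still exceeds `1/3`.
    have hτ : 0 ≤ 8 / 9 * t := by positivity
    refine (measureReal_bsum_gt_le hX hind hlaw hq _ hτ _).trans (Real.exp_le_exp.2 ?_)
    rw [← Finset.sum_mul]
    set τ := 8 / 9 * t with hτdef
    have hexp : Real.exp (τ * -1) - 1 - τ * -1 ≤ τ ^ 2 / 2 := by
      have hquad := Real.quadratic_le_exp_of_nonneg hτ
      have hinv : Real.exp (τ * -1) * Real.exp τ = 1 := by rw [← Real.exp_add]; simp
      have hp := Real.exp_pos (τ * -1)
      have h5 : Real.exp (τ * -1) * (1 + τ + τ ^ 2 / 2) ≤ 1 :=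
        (mul_le_mul_of_nonneg_left hquad hp.le).trans_eq hinv
      -- The product equals `1 + τ⁴/4`.
      have h6 : 1 ≤ (1 - τ + τ ^ 2 / 2) * (1 + τ + τ ^ 2 / 2) := by nlinarith [sq_nonneg (τ ^ 2)]
      have h7 : Real.exp (τ * -1) ≤ 1 - τ + τ ^ 2 / 2 :=
        le_of_mul_le_mul_right (h5.trans h6) (by positivity)
      linarith
    have hexp0 : 0 ≤ Real.exp (τ * -1) - 1 - τ * -1 := by
      have := Real.add_one_le_exp (τ * -1)
      linarith
    have h8 : (∑ s, q s) * (Real.exp (τ * -1) - 1 - τ * -1) ≤ E * (τ ^ 2 / 2) :=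
      mul_le_mul hqE hexp hexp0 hE.le
    have h9 : τ ^ 2 = 64 / 81 * t ^ 2 := by rw [hτdef]; ring
    rw [h9] at h8
    have h10 : τ * (τ * E) = 64 / 81 * (t ^ 2 * E) := by rw [hτdef]; ring
    have h11 : 0 ≤ t ^ 2 * E := by positivity
    linarith
  rw [two_mul (Real.exp (-l))]
  refine le_trans (measureReal_mono (fun ω hω => ?_) (measure_ne_top P _)) ((measureReal_union_le _ _).trans
    (add_le_add h1 h2))
  by_contra hcon
  simp only [Set.mem_union, Set.mem_ofPred_eq, not_or, not_lt] at hcon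
  exact hω ⟨hcon.1, by linarith⟩

end Tails

/-- The adjacency weights of a network. -/
def adj {ι κ : Type*} (g : ι → κ → Bool) (i : ι) (j : κ) : ℝ := if g i j = true then 1 else 0

lemma adj_nonneg {ι κ : Type*} (g : ι → κ → Bool) (i : ι) (j : κ) : 0 ≤ adj g i j := by
  rw [adj]; split_ifs <;> norm_num

/-! ### Union bound: the good event for the random network -/

section RandomNetwork

variable {Ω : Type*} [MeasurableSpace Ω] {P : Measure Ω} [IsProbabilityMeasure P]

omit [IsProbabilityMeasure P] in
lemma measureReal_not_forall_le {σ : Type*} [Fintype σ] {Q : σ → Ω → Prop} {c : ℝ}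
    (h : ∀ s, P.real {ω | ¬ Q s ω} ≤ c) : P.real {ω | ¬ ∀ s, Q s ω} ≤ Fintype.card σ * c := by
  have e : {ω | ¬ ∀ s, Q s ω} = ⋃ s ∈ (Finset.univ : Finset σ), {ω | ¬ Q s ω} := by
    ext ω; simp
  rw [e]
  refine (measureReal_biUnion_finset_le _ _).trans ?_
  refine (Finset.sum_le_sum fun s _ => h s).trans_eq ?_
  simp

lemma measureReal_not_and_le {Q₁ Q₂ : Ω → Prop} {c₁ c₂ : ℝ} (h₁ : P.real {ω | ¬ Q₁ ω} ≤ c₁)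
    (h₂ : P.real {ω | ¬ Q₂ ω} ≤ c₂) : P.real {ω | ¬ (Q₁ ω ∧ Q₂ ω)} ≤ c₁ + c₂ := by
  refine (measureReal_mono (fun ω hω => ?_) (measure_ne_top P _)).trans
    ((measureReal_union_le {ω | ¬ Q₁ ω} {ω | ¬ Q₂ ω}).trans (add_le_add h₁ h₂))
  exact not_and_or.1 hω

variable {ι κ : Type*} [Fintype ι] [Fintype κ] {G : Ω → ι → κ → Bool} {p : ι → κ → ℝ}
  (hG : ∀ i j, Measurable fun ω => G ω i j)
  (hind : iIndepFun (fun (e : ι × κ) (ω : Ω) => G ω e.1 e.2) P)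
  (hlaw : ∀ i j, P {ω | G ω i j = true} = ENNReal.ofReal (p i j)) (hp : ∀ i j, 0 ≤ p i j)
include hG hind hlaw hp

lemma measureReal_not_bernsteinRows_le {c : κ → ℝ} {A l : ℝ} (hA : 0 ≤ A) (hc : ∀ j, |c j| ≤ A)
    (hl : 0 < l) :
    P.real {ω | ¬ BernsteinRows (adj (G ω)) p l A c} ≤ Fintype.card ι * (2 * Real.exp (-l)) := by
  refine measureReal_not_forall_le fun i => ?_
  exact measureReal_bernstein (X := fun j ω => G ω i j) (hG i)
    (hind.precomp (g := fun j => (i, j)) fun _ _ h => (Prod.ext_iff.1 h).2) (hlaw i) (hp i) hA hc hl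

lemma measureReal_not_row_le {a t l : ℝ} (ha : 0 < a) (ht0 : 0 ≤ t)
    (ht : t ≤ 1) (hl : ∀ i, 3 * l ≤ t ^ 2 * ((∑ j, p i j) + a)) :
    P.real {ω | ¬ ∀ i, (∑ j, adj (G ω) i j - ∑ j, p i j ≤ t * ((∑ j, p i j) + a) ∧
      -(8 / 9 * t * ((∑ j, p i j) + a)) ≤ ∑ j, adj (G ω) i j - ∑ j, p i j)}
      ≤ Fintype.card ι * (2 * Real.exp (-l)) := by
  refine measureReal_not_forall_le fun i => ?_
  have := measureReal_chernoff (X := fun j ω => G ω i j) (hG i)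
    (hind.precomp (g := fun j => (i, j)) fun _ _ h => (Prod.ext_iff.1 h).2) (hlaw i) (hp i)
    (E := (∑ j, p i j) + a) (add_pos_of_nonneg_of_pos (Finset.sum_nonneg fun j _ => hp i j) ha)
    (by linarith) ht0 ht (hl i)
  simp only [bsum, mul_one, Finset.sum_sub_distrib] at this
  exact this

/-- With high probability, every solution of the bias equations on the random network is close to
the bias vector of the mean network. -/
theorem measureReal_not_nrm_bias_sub_le {a b t : ℝ}
    (ha : 0 < a) (hb : 0 < b) (ht0 : 0 ≤ t) (ht : t ≤ 1)
    {m x₁ x₂ : ι → ℝ} {v : κ → ℝ} {l M r R μ φ : ℝ} (hl : 0 < l) (hμ : 0 ≤ μ) (hφ : 0 ≤ φ)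
    (hr0 : 0 ≤ r) (hr : ∀ j, ((∑ i, p i j) + b)⁻¹ ≤ r) (hrM : r ≤ M)
    (hM : ∀ i, ((∑ j, p i j) + a)⁻¹ ≤ M)
    (hR : ∀ i, (∑ j, p i j) + a ≤ R) (hR0 : 0 ≤ R) (hMR : 1 ≤ M * R) (hlM : 3 * M * l = t ^ 2)
    (hm : ∀ i, |m i| ≤ μ) (hv : ∀ j, |v j| ≤ φ)
    (hx₁ : ∀ i, lap p a b x₁ i = -(a * m i)) (hx₂ : ∀ i, lap p a b x₂ i = b * transfer p b v i) :
    P.real {ω | ¬ ∀ x : ι → ℝ,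
        (∀ i, lap (adj (G ω)) a b x i = -(a * m i) + b * transfer (adj (G ω)) b v i) →
        a * nrm (fun i => x i - (x₁ i + x₂ i)) ≤
          16 * t * R * (√(Fintype.card ι : ℝ) * μ + b / a * √(R * r) * √(Fintype.card κ : ℝ) * φ)
            + b * ((2 + 2 * √(R / b)) * (t * √(Fintype.card κ : ℝ) * φ))}
      ≤ (8 * Fintype.card ι + 6 * Fintype.card κ) * Real.exp (-l) := by
  have hpR : ∀ i, ∑ j, p i j ≤ R := fun i => by linarith [hR i]
  have hM0 : 0 ≤ M := hr0.trans hrM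
  -- Since `M` dominates all inverse regularized mean degrees, the Chernoff exponent `t²E/3` is at
  -- least `l` for every row and column.
  have hscale : ∀ E : ℝ, 0 < E → E⁻¹ ≤ M → 3 * l ≤ t ^ 2 * E := by
    intro E hE h
    have h1 : 1 ≤ M * E := by
      have := mul_le_mul_of_nonneg_right h hE.le
      rwa [inv_mul_cancel₀ hE.ne'] at this
    rw [← hlM]
    nlinarith
  have hE := col_add_pos hp hb
  have hGc : ∀ j i, Measurable fun ω => G ω i j := fun j i => hG i j
  have hindc : iIndepFun (fun (e : κ × ι) (ω : Ω) => G ω e.2 e.1) P :=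
    hind.precomp (g := Prod.swap) Prod.swap_injective
  have hlawc : ∀ j i, P {ω | G ω i j = true} = ENNReal.ofReal (p i j) := fun j i => hlaw i j
  have hpc : ∀ j i, 0 ≤ p i j := fun j i => hp i j
  have hA₁ := abs_workerPart_le hp ha hb hx₁ hm
  have hA₂ := abs_firmPart_le hp ha hb hx₂ hv hφ hr0 hr hpR
  have hA₂0 : 0 ≤ b / a * (R * r * φ) := by positivity
  -- Four events range over rows (`e₁, e₅, e₆, e₇`) and three over columns (`e₂, e₃, e₄`), each with
  -- a two-sided tail: hence `8` and `6`.
  have e₁ := measureReal_not_row_le hG hind hlaw hp ha ht0 ht fun i =>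
    hscale _ (add_pos_of_nonneg_of_pos (Finset.sum_nonneg fun j _ => hp i j) ha) (hM i)
  have e₂ := measureReal_not_row_le (G := fun ω j i => G ω i j) (p := fun j i => p i j)
    hGc hindc hlawc hpc hb ht0 ht fun j => hscale _ (hE j) ((hr j).trans hrM)
  have e₃ := measureReal_not_bernsteinRows_le (G := fun ω j i => G ω i j) (p := fun j i => p i j)
    hGc hindc hlawc hpc hμ hA₁ hl
  have e₄ := measureReal_not_bernsteinRows_le (G := fun ω j i => G ω i j) (p := fun j i => p i j)
    hGc hindc hlawc hpc hA₂0 hA₂ hl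
  have e₅ := measureReal_not_bernsteinRows_le hG hind hlaw hp hμ (abs_average_le hp hb hA₁ hμ) hl
  have e₆ := measureReal_not_bernsteinRows_le hG hind hlaw hp hA₂0
    (abs_average_le hp hb hA₂ hA₂0) hl
  have e₇ := measureReal_not_bernsteinRows_le hG hind hlaw hp (mul_nonneg hM0 hφ)
    (c := fun j => v j / ((∑ i, p i j) + b)) (fun j => by
      rw [abs_div, abs_of_pos (hE j), div_eq_inv_mul]
      exact mul_le_mul ((hr j).trans hrM) (hv j) (abs_nonneg _) hM0) hl
  have e := measureReal_not_and_le e₁ <| measureReal_not_and_le e₂ <| measureReal_not_and_le e₃ <|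
    measureReal_not_and_le e₄ <| measureReal_not_and_le e₅ <| measureReal_not_and_le e₆ e₇
  refine (measureReal_mono (fun ω hω => ?_) (measure_ne_top P _)).trans (e.trans_eq (by ring))
  refine fun hgood => hω fun x hx => ?_
  obtain ⟨g₁, g₂, g₃, g₄, g₅, g₆, g₇⟩ := hgood
  have hclose : DegreesClose (adj (G ω)) p a b t := by
    refine ⟨adj_nonneg _, hp, fun i => ?_, fun j => ?_, fun j => ?_⟩
    · have h0 : 0 ≤ t * ((∑ j, p i j) + a) := mul_nonneg ht0
        (add_nonneg (Finset.sum_nonneg fun j _ => hp i j) ha.le)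
      have h1 := g₁ i
      exact abs_le.2 ⟨by linarith [h1.2], h1.1⟩
    · have h0 : 0 ≤ t * ((∑ i, p i j) + b) := mul_nonneg ht0 (hE j).le
      have h1 : _ ≤ _ ∧ _ ≤ _ := g₂ j
      exact abs_le.2 ⟨by have := h1.2; simp only [adj] at this ⊢; linarith, h1.1⟩
    · have h1 := (g₂ j).2
      have h2 := mul_le_of_le_one_left (hE j).le ht
      simp only [adj] at h1 ⊢
      linarith
  exact hclose.nrm_bias_sub_le ha hb ht0 ht hl.le hμ hφ hr0 hr hrM hR hR0 hMR hlM hm hv hx hx₁ hx₂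
    g₃ g₅ g₄ g₆ g₇

end RandomNetwork

variable {n p : ℕ}

/-! ### Laplacian matrices -/

lemma Df_inv {B : Fin n → Fin p → ℝ} (hB : ∀ i j, 0 ≤ B i j) {b : ℝ} (hb : 0 < b) :
    (Df (of B) b)⁻¹ = Matrix.diagonal fun j => ((∑ i, B i j) + b)⁻¹ := by
  refine Matrix.inv_eq_right_inv ?_
  rw [Df, Matrix.diagonal_mul_diagonal, ← Matrix.diagonal_one]
  congr 1
  funext j
  simp only [of_apply]
  exact mul_inv_cancel₀ (col_add_pos hB hb j).ne'

lemma mul_Df_inv_mulVec {B : Fin n → Fin p → ℝ} (hB : ∀ i j, 0 ≤ B i j) {b : ℝ} (hb : 0 < b)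
    (v : Fin p → ℝ) : (of B * (Df (of B) b)⁻¹) *ᵥ v = transfer B b v := by
  funext i
  rw [Df_inv hB hb, ← Matrix.mulVec_mulVec, transfer, Matrix.mulVec, dotProduct]
  exact Finset.sum_congr rfl fun j _ => by rw [of_apply, Matrix.mulVec_diagonal, div_eq_inv_mul]

lemma Lw_mulVec {B : Fin n → Fin p → ℝ} (hB : ∀ i j, 0 ≤ B i j) {a b : ℝ} (hb : 0 < b)
    (x : Fin n → ℝ) : Lw (of B) a b *ᵥ x = lap B a b x := by
  funext i
  rw [Lw, Matrix.sub_mulVec, ← Matrix.mulVec_mulVec, mul_Df_inv_mulVec hB hb, Pi.sub_apply, Dw,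
    Matrix.mulVec_diagonal, lap, transfer]
  rfl

/-- The maximum principle leaves no kernel. -/
lemma isUnit_Lw {B : Fin n → Fin p → ℝ} (hB : ∀ i j, 0 ≤ B i j) {a b : ℝ} (ha : 0 < a)
    (hb : 0 < b) : IsUnit (Lw (of B) a b) := by
  rw [← Matrix.mulVec_injective_iff_isUnit]
  intro x y hxy
  have hxy : Lw (of B) a b *ᵥ x = Lw (of B) a b *ᵥ y := hxy
  rw [Lw_mulVec hB hb, Lw_mulVec hB hb] at hxy
  funext i
  have := abs_le_of_abs_lap_le hB hb ha (x := fun i => x i - y i) (A := 0) (fun i => by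
    rw [lap_sub, hxy, sub_self, abs_zero]) i
  rw [zero_div] at this
  linarith [abs_nonpos_iff.1 this]

lemma lap_Lw_inv_mulVec {B : Fin n → Fin p → ℝ} (hB : ∀ i j, 0 ≤ B i j) {a b : ℝ}
    (ha : 0 < a) (hb : 0 < b) (y : Fin n → ℝ) : lap B a b ((Lw (of B) a b)⁻¹ *ᵥ y) = y := by
  rw [← Lw_mulVec hB hb, Matrix.mulVec_mulVec,
    Matrix.mul_nonsing_inv _ ((Matrix.isUnit_iff_isUnit_det _).1 (isUnit_Lw hB ha hb)),
    Matrix.one_mulVec]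

/-! ### The normal equations -/

/-- The matrix of the normal equations of the ridge estimator. -/
def normalMatrix (g : Fin n → Fin p → Bool) (a b : ℝ) : Matrix (Fin n ⊕ Fin p) (Fin n ⊕ Fin p) ℝ :=
  Matrix.fromBlocks ((W g)ᵀ * W g + a • 1) ((W g)ᵀ * F g) ((F g)ᵀ * W g) ((F g)ᵀ * F g + b • 1)

lemma sum_obs (g : Fin n → Fin p → Bool) (f : Fin n → Fin p → ℝ) :
    ∑ o : Obs g, f o.1.1 o.1.2 = ∑ i, ∑ j, adj g i j * f i j := by
  rw [← Fintype.sum_prod_type' fun i j => adj g i j * f i j]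
  have h := Finset.sum_subtype (p := fun e : Fin n × Fin p => g e.1 e.2 = true)
    (F := inferInstance) (Finset.univ.filter fun e : Fin n × Fin p => g e.1 e.2 = true) (by simp)
    (fun e => f e.1 e.2)
  rw [← h, Finset.sum_filter]
  exact Finset.sum_congr rfl fun e _ => by simp [adj]

lemma W_transpose_mulVec (g : Fin n → Fin p → Bool) (u : Fin n → Fin p → ℝ) (i : Fin n) :
    ((W g)ᵀ *ᵥ fun o => u o.1.1 o.1.2) i = ∑ j, adj g i j * u i j := by
  have := sum_obs g fun i' j => (if i' = i then 1 else 0) * u i' j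
  simp only [Matrix.mulVec, dotProduct, Matrix.transpose_apply, W, Matrix.of_apply]
  rw [this, Finset.sum_eq_single i]
  · simp
  · intro b _ hb; simp [hb]
  · simp

lemma F_transpose_mulVec (g : Fin n → Fin p → Bool) (u : Fin n → Fin p → ℝ) (j : Fin p) :
    ((F g)ᵀ *ᵥ fun o => u o.1.1 o.1.2) j = ∑ i, adj g i j * u i j := by
  have := sum_obs g fun i j' => (if j' = j then 1 else 0) * u i j'
  simp only [Matrix.mulVec, dotProduct, Matrix.transpose_apply, F, Matrix.of_apply]
  rw [this]
  refine Finset.sum_congr rfl fun i _ => ?_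
  rw [Finset.sum_eq_single j]
  · simp
  · intro b _ hb; simp [hb]
  · simp

lemma W_mulVec (g : Fin n → Fin p → Bool) (x : Fin n → ℝ) :
    W g *ᵥ x = fun o => x o.1.1 := by
  funext o
  simp [Matrix.mulVec, dotProduct, W]

lemma F_mulVec (g : Fin n → Fin p → Bool) (y : Fin p → ℝ) :
    F g *ᵥ y = fun o => y o.1.2 := by
  funext o
  simp [Matrix.mulVec, dotProduct, F]

lemma normalMatrix_mulVec (g : Fin n → Fin p → Bool) (a b : ℝ) (x : Fin n → ℝ) (y : Fin p → ℝ) :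
    normalMatrix g a b *ᵥ Sum.elim x y = Sum.elim
      (fun i => ((∑ j, adj g i j) + a) * x i + ∑ j, adj g i j * y j)
      (fun j => (∑ i, adj g i j * x i) + ((∑ i, adj g i j) + b) * y j) := by
  rw [normalMatrix, Matrix.fromBlocks_mulVec]
  simp only [Sum.elim_comp_inl, Sum.elim_comp_inr, Matrix.add_mulVec, ← Matrix.mulVec_mulVec,
    W_mulVec, F_mulVec, Matrix.smul_mulVec, Matrix.one_mulVec]
  congr 1
  · funext i
    have h1 := W_transpose_mulVec g (fun i _ => x i) i
    have h2 := W_transpose_mulVec g (fun _ j => y j) i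
    rw [← Finset.sum_mul] at h1
    simp only [Pi.add_apply, h1, h2, Pi.smul_apply, smul_eq_mul]
    ring
  · funext j
    have h1 := F_transpose_mulVec g (fun i _ => x i) j
    have h2 := F_transpose_mulVec g (fun _ j => y j) j
    rw [← Finset.sum_mul] at h2
    simp only [Pi.add_apply, h1, h2, Pi.smul_apply, smul_eq_mul]
    ring

section NormalEquations

variable {g : Fin n → Fin p → Bool} {a b : ℝ} {x : Fin n → ℝ} {y : Fin p → ℝ} {m : Fin n → ℝ}
  {v : Fin p → ℝ}

/-- Schur complement: the firm equations are solved for `y` and substituted in the worker equations.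
-/
lemma lap_of_normalMatrix (hb : 0 < b)
    (h : normalMatrix g a b *ᵥ Sum.elim x y
      = Sum.elim (fun i => -(a * m i)) (fun j => -(b * v j))) (i : Fin n) :
    lap (adj g) a b x i = -(a * m i) + b * transfer (adj g) b v i := by
  rw [normalMatrix_mulVec] at h
  have h1 : ((∑ j, adj g i j) + a) * x i + ∑ j, adj g i j * y j = -(a * m i) :=
    congrFun h (Sum.inl i)
  have h2 : ∀ j, (∑ i, adj g i j * x i) / ((∑ i, adj g i j) + b)
      = -y j - b * (v j / ((∑ i, adj g i j) + b)) := fun j => by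
    have h3 : (∑ i, adj g i j * x i) + ((∑ i, adj g i j) + b) * y j = -(b * v j) :=
      congrFun h (Sum.inr j)
    have := (col_add_pos (adj_nonneg g) hb j).ne'
    field_simp
    linarith
  rw [lap, transfer, Finset.mul_sum]
  simp_rw [h2]
  have h4 : ∑ j, adj g i j * (-y j - b * (v j / ((∑ i, adj g i j) + b)))
      = -(∑ j, adj g i j * y j) - ∑ j, b * (adj g i j * (v j / ((∑ i, adj g i j) + b))) := by
    rw [← Finset.sum_neg_distrib, ← Finset.sum_sub_distrib]
    exact Finset.sum_congr rfl fun j _ => by ring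
  rw [h4]
  linarith

/-- The normal equations are symmetric under exchanging workers with firms and transposing the
network. -/
lemma lap_transpose_of_normalMatrix (ha : 0 < a)
    (h : normalMatrix g a b *ᵥ Sum.elim x y
      = Sum.elim (fun i => -(a * m i)) (fun j => -(b * v j))) (j : Fin p) :
    lap (adj fun j i => g i j) b a y j = -(b * v j) + a * transfer (adj fun j i => g i j) a m j := by
  refine lap_of_normalMatrix (g := fun j i => g i j) (x := y) (y := x) ha ?_ j
  rw [normalMatrix_mulVec] at h ⊢
  congr 1
  · funext j
    rw [add_comm]
    exact congrFun h (Sum.inr j)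
  · funext i
    rw [add_comm]
    exact congrFun h (Sum.inl i)

lemma isUnit_normalMatrix (g : Fin n → Fin p → Bool) (ha : 0 < a) (hb : 0 < b) :
    IsUnit (normalMatrix g a b) := by
  rw [← Matrix.mulVec_injective_iff_isUnit]
  have h0 : ∀ z, normalMatrix g a b *ᵥ z = 0 → z = 0 := by
    intro z hz
    have h : normalMatrix g a b *ᵥ Sum.elim (z ∘ Sum.inl) (z ∘ Sum.inr)
        = Sum.elim (fun i => -(a * (0 : Fin n → ℝ) i)) (fun j => -(b * (0 : Fin p → ℝ) j)) := by
      rw [Sum.elim_comp_inl_inr, hz]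
      funext s
      rcases s with s | s <;> simp
    have hx : ∀ i, z (Sum.inl i) = 0 := fun i => by
      have := abs_le_of_abs_lap_le (adj_nonneg g) hb ha (x := z ∘ Sum.inl) (A := 0)
        (fun i => by rw [lap_of_normalMatrix hb h]; simp [transfer]) i
      simpa using this
    have hy : ∀ j, z (Sum.inr j) = 0 := fun j => by
      have := abs_le_of_abs_lap_le (adj_nonneg fun j i => g i j) ha hb (x := z ∘ Sum.inr) (A := 0)
        (fun j => by rw [lap_transpose_of_normalMatrix ha h]; simp [transfer]) j
      simpa using this
    funext s
    rcases s with s | s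
    · exact hx s
    · exact hy s
  intro z z' hzz
  have := h0 (z - z') (by rw [Matrix.mulVec_sub]; exact sub_eq_zero.2 hzz)
  exact sub_eq_zero.1 this

/-- Estimation error of the ridge estimator on a given network. -/
lemma ridge_sub (g : Fin n → Fin p → Bool) (ha : 0 < a) (hb : 0 < b) (x : Fin n → ℝ)
    (y : Fin p → ℝ) (u : Fin n → Fin p → ℝ) :
    ridge g a b (Y g x y u) - Sum.elim x y = (normalMatrix g a b)⁻¹ *ᵥ Sum.elim
      (fun i => (∑ j, adj g i j * u i j) - a * x i)
      (fun j => (∑ i, adj g i j * u i j) - b * y j) := by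
  have hu := isUnit_normalMatrix g ha hb
  have e : Sum.elim ((W g)ᵀ *ᵥ Y g x y u) ((F g)ᵀ *ᵥ Y g x y u)
      = normalMatrix g a b *ᵥ Sum.elim x y + Sum.elim
      (fun i => (∑ j, adj g i j * u i j) - a * x i)
      (fun j => (∑ i, adj g i j * u i j) - b * y j) := by
    have hY : Y g x y u = fun o => (fun i j => x i + y j + u i j) o.1.1 o.1.2 := by
      rw [Y, W_mulVec, F_mulVec]; rfl
    rw [hY, normalMatrix_mulVec]
    funext s
    rcases s with i | j
    · simp only [Sum.elim_inl, Pi.add_apply]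
      rw [W_transpose_mulVec g fun i j => x i + y j + u i j]
      simp only [mul_add, Finset.sum_add_distrib, ← Finset.sum_mul]
      ring
    · simp only [Sum.elim_inr, Pi.add_apply]
      rw [F_transpose_mulVec g fun i j => x i + y j + u i j]
      simp only [mul_add, Finset.sum_add_distrib, ← Finset.sum_mul]
      ring
  have h1 : ridge g a b (Y g x y u)
      = (normalMatrix g a b)⁻¹ *ᵥ Sum.elim ((W g)ᵀ *ᵥ Y g x y u) ((F g)ᵀ *ᵥ Y g x y u) := rfl
  rw [h1, e, Matrix.mulVec_add, Matrix.mulVec_mulVec,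
    Matrix.nonsing_inv_mul _ ((Matrix.isUnit_iff_isUnit_det _).1 hu), Matrix.one_mulVec,
    add_sub_cancel_left]

/-- The conditional bias on a given network. -/
def biasVec (g : Fin n → Fin p → Bool) (a b : ℝ) (m : Fin n → ℝ) (v : Fin p → ℝ) :
    Fin n ⊕ Fin p → ℝ :=
  (normalMatrix g a b)⁻¹ *ᵥ Sum.elim (fun i => -(a * m i)) (fun j => -(b * v j))

lemma normalMatrix_mulVec_biasVec (g : Fin n → Fin p → Bool) (ha : 0 < a) (hb : 0 < b)
    (m : Fin n → ℝ) (v : Fin p → ℝ) :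
    normalMatrix g a b *ᵥ Sum.elim (fun i => biasVec g a b m v (Sum.inl i))
      (fun j => biasVec g a b m v (Sum.inr j))
      = Sum.elim (fun i => -(a * m i)) (fun j => -(b * v j)) := by
  have e : Sum.elim (fun i => biasVec g a b m v (Sum.inl i))
      (fun j => biasVec g a b m v (Sum.inr j)) = biasVec g a b m v :=
    Sum.elim_comp_inl_inr _
  rw [e, biasVec, Matrix.mulVec_mulVec, Matrix.mul_nonsing_inv _
    ((Matrix.isUnit_iff_isUnit_det _).1 (isUnit_normalMatrix g ha hb)), Matrix.one_mulVec]

end NormalEquations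

/-! ### Conditional expectations given the network -/

section CondCentered

variable {Ω : Type*} [mΩ : MeasurableSpace Ω] {P : Measure Ω} [IsProbabilityMeasure P]

/-- An integrable variable with zero conditional expectation. -/
def CondCentered {mΩ : MeasurableSpace Ω} (P : Measure Ω) (m : MeasurableSpace Ω) (Z : Ω → ℝ) : Prop :=
  Integrable Z P ∧ P[Z|m] =ᵐ[P] 0

omit [IsProbabilityMeasure P] in
lemma CondCentered.add {m : MeasurableSpace Ω} {Z Z' : Ω → ℝ} (h : CondCentered P m Z)
    (h' : CondCentered P m Z') : CondCentered P m fun ω => Z ω + Z' ω := by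
  refine ⟨h.1.add h'.1, (condExp_add h.1 h'.1 m).trans ?_⟩
  filter_upwards [h.2, h'.2] with ω h1 h2
  simp [h1, h2]

omit [IsProbabilityMeasure P] in
lemma CondCentered.sum {m : MeasurableSpace Ω} {σ : Type*} [Fintype σ] {Z : σ → Ω → ℝ}
    (h : ∀ s, CondCentered P m (Z s)) : CondCentered P m fun ω => ∑ s, Z s ω := by
  have e : (fun ω => ∑ s, Z s ω) = ∑ s, Z s := by funext ω; simp
  rw [e]
  refine ⟨integrable_finsetSum' _ fun s _ => (h s).1,
    (condExp_finsetSum (fun s _ => (h s).1) m).trans ?_⟩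
  filter_upwards [ae_all_iff.2 fun s => (h s).2] with ω hω
  simp [hω]

variable {β : Type*} [MeasurableSpace β] [DiscreteMeasurableSpace β] [Finite β] {G : Ω → β}

omit mΩ [DiscreteMeasurableSpace β] [MeasurableSpace β] in
lemma exists_norm_comp_le (ψ : β → ℝ) : ∃ C, ∀ ω, ‖ψ (G ω)‖ ≤ C := by
  obtain ⟨C, hC⟩ := (Set.finite_range fun x => ‖ψ x‖).bddAbove
  exact ⟨C, fun ω => hC ⟨G ω, rfl⟩⟩

/-- There are finitely many networks, so `ψ (G ω)` is bounded and measurable and can be pulled out;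
independence makes the rest the plain mean, which is zero. -/
lemma condCentered_mul (hG : Measurable G) (ψ : β → ℝ) {ξ : Ω → ℝ} (hξ : Measurable ξ)
    (hint : Integrable ξ P) (hmean : ∫ ω, ξ ω ∂P = 0) (hind : IndepFun ξ G P) :
    CondCentered P (MeasurableSpace.comap G inferInstance) fun ω => ψ (G ω) * ξ ω := by
  obtain ⟨C, hC⟩ := exists_norm_comp_le (G := G) ψ
  have hψ : Measurable ψ := Measurable.of_discrete
  have hi : Integrable (fun ω => ψ (G ω) * ξ ω) P :=
    hint.bdd_mul (hψ.comp hG).aestronglyMeasurable (Filter.Eventually.of_forall hC)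
  have hs : StronglyMeasurable[MeasurableSpace.comap G inferInstance] fun ω => ψ (G ω) :=
    (hψ.comp (comap_measurable G)).stronglyMeasurable
  refine ⟨hi, (condExp_mul_of_stronglyMeasurable_left hs hi hint).trans ?_⟩
  have h0 := condExp_indep_eq (μ := P) (m₁ := MeasurableSpace.comap ξ inferInstance) hξ.comap_le
    hG.comap_le (comap_measurable ξ).stronglyMeasurable ((IndepFun_iff_Indep _ _ _).1 hind)
  filter_upwards [h0] with ω hω
  simp [hω, hmean]

lemma CondCentered.condExp_add_eq {Z : Ω → ℝ} (hG : Measurable G)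
    (h : CondCentered P (MeasurableSpace.comap G inferInstance) Z) (ψ : β → ℝ) :
    P[fun ω => ψ (G ω) + Z ω | MeasurableSpace.comap G inferInstance] =ᵐ[P] fun ω => ψ (G ω) := by
  obtain ⟨C, hC⟩ := exists_norm_comp_le (G := G) ψ
  have hψ : Measurable ψ := Measurable.of_discrete
  have hi : Integrable (fun ω => ψ (G ω)) P :=
    Integrable.of_bound (hψ.comp hG).aestronglyMeasurable C (Filter.Eventually.of_forall hC)
  have hs : StronglyMeasurable[MeasurableSpace.comap G inferInstance] fun ω => ψ (G ω) :=
    (hψ.comp (comap_measurable G)).stronglyMeasurable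
  refine (condExp_add hi h.1 _).trans ?_
  filter_upwards [h.2] with ω hω
  rw [Pi.add_apply, hω, condExp_of_stronglyMeasurable hG.comap_le hs hi]
  simp

end CondCentered

/-! ### The conditional bias as a function of the network -/

section Bias

variable {n p : ℕ} {Ω : Type*} [MeasurableSpace Ω] {P : Measure Ω} [IsProbabilityMeasure P]
  {G : Ω → Fin n → Fin p → Bool} (hG : Measurable G)
  {m : Fin n → ℝ} {v : Fin p → ℝ}
  {Uw : Ω → Fin n → ℝ} {Uf : Ω → Fin p → ℝ} {U : Ω → Fin n → Fin p → ℝ}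
  (hUw : Measurable Uw) (hUf : Measurable Uf) (hU : Measurable U)
  (hUw_int : ∀ i, Integrable (fun ω => Uw ω i) P)
  (hUf_int : ∀ j, Integrable (fun ω => Uf ω j) P)
  (hU_int : ∀ i j, Integrable (fun ω => U ω i j) P)
  (hUw_mean : ∀ i, ∫ ω, Uw ω i ∂P = 0)
  (hUf_mean : ∀ j, ∫ ω, Uf ω j ∂P = 0)
  (hU_mean : ∀ i j, ∫ ω, U ω i j ∂P = 0)
  (hUw_indep : IndepFun Uw G P) (hUf_indep : IndepFun Uf G P) (hU_indep : IndepFun U G P)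
  {mu : Ω → Fin n → ℝ} (hmu : ∀ ω, mu ω = m + Uw ω)
  {phi : Ω → Fin p → ℝ} (hphi : ∀ ω, phi ω = v + Uf ω)
  {a b : ℝ} (ha : 0 < a) (hb : 0 < b)
include hG hUw hUf hU hUw_int hUf_int hU_int hUw_mean hUf_mean hU_mean hUw_indep hUf_indep
  hU_indep hmu hphi ha hb

/-- The conditional expectation of the estimation error given the network. -/
lemma condExp_ridge_sub (s : Fin n ⊕ Fin p) :
    P[fun x => ridge (G x) a b (Y (G x) (mu x) (phi x) (U x)) s - Sum.elim (mu x) (phi x) s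
      | MeasurableSpace.comap G inferInstance] =ᵐ[P] fun ω => biasVec (G ω) a b m v s := by
  have hUwc : ∀ (ψ : (Fin n → Fin p → Bool) → ℝ) i,
      CondCentered P (MeasurableSpace.comap G inferInstance) fun ω => ψ (G ω) * Uw ω i := fun ψ i =>
    condCentered_mul hG ψ ((measurable_pi_apply i).comp hUw) (hUw_int i) (hUw_mean i)
      (hUw_indep.comp (measurable_pi_apply i) measurable_id)
  have hUfc : ∀ (ψ : (Fin n → Fin p → Bool) → ℝ) j,
      CondCentered P (MeasurableSpace.comap G inferInstance) fun ω => ψ (G ω) * Uf ω j := fun ψ j =>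
    condCentered_mul hG ψ ((measurable_pi_apply j).comp hUf) (hUf_int j) (hUf_mean j)
      (hUf_indep.comp (measurable_pi_apply j) measurable_id)
  have hUc : ∀ (ψ : (Fin n → Fin p → Bool) → ℝ) i j,
      CondCentered P (MeasurableSpace.comap G inferInstance) fun ω => ψ (G ω) * U ω i j :=
    fun ψ i j =>
      have hm : Measurable fun u : Fin n → Fin p → ℝ => u i j :=
        (measurable_pi_apply j).comp (measurable_pi_apply i)
      condCentered_mul hG ψ (hm.comp hU) (hU_int i j) (hU_mean i j)
        (hU_indep.comp hm measurable_id)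
  -- Each noise variable enters linearly with a coefficient depending only on the network, so
  -- separate independence of `Uw`, `Uf` and `U` from `G` is enough.
  have hZ := ((CondCentered.sum (σ := Fin n) fun i => (CondCentered.sum (σ := Fin p) fun j =>
      hUc (fun g => (normalMatrix g a b)⁻¹ s (Sum.inl i) * adj g i j) i j).add
        (hUwc (fun g => -((normalMatrix g a b)⁻¹ s (Sum.inl i) * a)) i))).add
    (CondCentered.sum (σ := Fin p) fun j => (CondCentered.sum (σ := Fin n) fun i =>
      hUc (fun g => (normalMatrix g a b)⁻¹ s (Sum.inr j) * adj g i j) i j).add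
        (hUfc (fun g => -((normalMatrix g a b)⁻¹ s (Sum.inr j) * b)) j))
  refine Filter.EventuallyEq.trans (Filter.EventuallyEq.of_eq ?_)
    (hZ.condExp_add_eq hG fun g => biasVec g a b m v s)
  congr 1
  funext ω
  have h := congrFun (ridge_sub (G ω) ha hb (mu ω) (phi ω) (U ω)) s
  rw [Pi.sub_apply] at h
  rw [h, biasVec, Matrix.mulVec, Matrix.mulVec, dotProduct, dotProduct, Fintype.sum_sum_type,
    Fintype.sum_sum_type]
  simp only [Sum.elim_inl, Sum.elim_inr, hmu, hphi, Pi.add_apply]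
  rw [add_add_add_comm, ← Finset.sum_add_distrib, ← Finset.sum_add_distrib]
  congr 1
  · refine Finset.sum_congr rfl fun i _ => ?_
    have e : ∑ j, (normalMatrix (G ω) a b)⁻¹ s (Sum.inl i) * adj (G ω) i j * U ω i j
        = (normalMatrix (G ω) a b)⁻¹ s (Sum.inl i) * ∑ j, adj (G ω) i j * U ω i j := by
      rw [Finset.mul_sum]; simp_rw [mul_assoc]
    rw [e]
    ring
  · refine Finset.sum_congr rfl fun j _ => ?_
    have e : ∑ i, (normalMatrix (G ω) a b)⁻¹ s (Sum.inr j) * adj (G ω) i j * U ω i j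
        = (normalMatrix (G ω) a b)⁻¹ s (Sum.inr j) * ∑ i, adj (G ω) i j * U ω i j := by
      rw [Finset.mul_sum]; simp_rw [mul_assoc]
    rw [e]
    ring

lemma biasMu_ae_eq : ∀ᵐ ω ∂P, biasMu P G a b mu phi U ω
    = WithLp.toLp 2 fun i => biasVec (G ω) a b m v (Sum.inl i) := by
  filter_upwards [ae_all_iff.2 fun i => condExp_ridge_sub hG hUw hUf hU hUw_int hUf_int hU_int
    hUw_mean hUf_mean hU_mean hUw_indep hUf_indep hU_indep hmu hphi ha hb (Sum.inl i)] with ω hω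
  rw [biasMu]
  congr 1
  funext i
  exact hω i

lemma biasPhi_ae_eq : ∀ᵐ ω ∂P, biasPhi P G a b mu phi U ω
    = WithLp.toLp 2 fun j => biasVec (G ω) a b m v (Sum.inr j) := by
  filter_upwards [ae_all_iff.2 fun j => condExp_ridge_sub hG hUw hUf hU hUw_int hUf_int hU_int
    hUw_mean hUf_mean hU_mean hUw_indep hUf_indep hU_indep hmu hphi ha hb (Sum.inr j)] with ω hω
  rw [biasPhi]
  congr 1
  funext j
  exact hω j

end Bias

end TwoWay

/-! ### Expected degrees of the block model -/

namespace BlockModel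

variable {n p K : ℕ} (S : BlockModel n p K)

lemma meanB_nonneg (i : Fin n) (j : Fin p) : 0 ≤ S.meanB i j :=
  mul_nonneg (mul_nonneg (by positivity) (S.theta_nonneg j)) (S.C_nonneg _ _)

lemma size_pos (a : Fin K) : 0 < S.size a := by
  obtain ⟨i, hi⟩ := S.k_surjective a
  exact Finset.card_pos.2 ⟨i, by simp [hi]⟩

lemma sum_meanB_row (i : Fin n) : ∑ j, S.meanB i j = S.workerDegree (S.k i) := by
  have h : ∑ j, S.theta j * S.C (S.k i) (S.l j) = ∑ b, S.C (S.k i) b := by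
    rw [← Finset.sum_fiberwise (s := Finset.univ) (g := S.l)]
    refine Finset.sum_congr rfl fun b _ => ?_
    calc _ = ∑ j with S.l j = b, S.theta j * S.C (S.k i) b :=
          Finset.sum_congr rfl fun j hj => by rw [(Finset.mem_filter.1 hj).2]
      _ = _ := by rw [← Finset.sum_mul, S.theta_sum, one_mul]
  rw [workerDegree, ← h, Finset.mul_sum]
  exact Finset.sum_congr rfl fun j _ => by rw [meanB, of_apply, mul_assoc]

lemma sum_meanB_col (j : Fin p) : ∑ i, S.meanB i j = S.firmDegree j := by
  rw [← Finset.sum_fiberwise (s := Finset.univ) (g := S.k), firmDegree, Finset.mul_sum]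
  refine Finset.sum_congr rfl fun a _ => ?_
  calc _ = ∑ i with S.k i = a, 1 / (S.size a : ℝ) * S.theta j * S.C a (S.l j) :=
        Finset.sum_congr rfl fun i hi => by rw [meanB, of_apply, (Finset.mem_filter.1 hi).2]
    _ = (S.size a : ℝ) * (1 / (S.size a : ℝ) * S.theta j * S.C a (S.l j)) := by
        rw [Finset.sum_const, nsmul_eq_mul, size]
    _ = _ := by
        have : (S.size a : ℝ) ≠ 0 := Nat.cast_ne_zero.2 (S.size_pos a).ne'
        field_simp

lemma workerDegree_nonneg (a : Fin K) : 0 ≤ S.workerDegree a :=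
  mul_nonneg (by positivity) (Finset.sum_nonneg fun b _ => S.C_nonneg a b)

lemma firmDegree_nonneg (j : Fin p) : 0 ≤ S.firmDegree j :=
  mul_nonneg (S.theta_nonneg j) (Finset.sum_nonneg fun a _ => S.C_nonneg a _)

lemma minW_nonneg : 0 ≤ S.minW := Real.iInf_nonneg S.workerDegree_nonneg
lemma minF_nonneg : 0 ≤ S.minF := Real.iInf_nonneg S.firmDegree_nonneg

lemma minW_le (a : Fin K) : S.minW ≤ S.workerDegree a :=
  ciInf_le (Set.finite_range _).bddBelow a
lemma le_maxW (a : Fin K) : S.workerDegree a ≤ S.maxW :=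
  le_ciSup (Set.finite_range S.workerDegree).bddAbove a
lemma minF_le (j : Fin p) : S.minF ≤ S.firmDegree j :=
  ciInf_le (Set.finite_range _).bddBelow j
lemma le_maxF (j : Fin p) : S.firmDegree j ≤ S.maxF :=
  le_ciSup (Set.finite_range S.firmDegree).bddAbove j

lemma Zw_mulVec (x : Fin K → ℝ) (i : Fin n) : (S.Zw *ᵥ x) i = x (S.k i) := by
  simp [Zw, Matrix.mulVec, dotProduct]

lemma Zf_mulVec (x : Fin K → ℝ) (j : Fin p) : (S.Zf *ᵥ x) j = x (S.l j) := by
  simp [Zf, Matrix.mulVec, dotProduct]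

end BlockModel

/-! ### From the deterministic estimate to the stated constants -/

namespace TwoWay

/-- The estimate proved is stronger than the one stated: `ρ`, `χ` and `R / a` are at least 1, and
the extra factors only enlarge the right-hand side. -/
lemma bias_bound_le {a b t R E ρ χ μ φ N N' : ℝ} (ha : 0 < a) (hb : 0 < b) (ht : 0 ≤ t)
    (haR : a ≤ R) (hρ : 1 ≤ ρ) (hχ : 1 ≤ χ) (hμ : 0 ≤ μ) (hφ : 0 ≤ φ) :
    16 * t * R * (√N * μ + b / a * √(R * E⁻¹) * √N' * φ)
        + b * ((2 + 2 * √(R / b)) * (t * √N' * φ))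
      ≤ a * ((5 + 16 * ρ) * (R / a ^ 2) * t * (a * √N * μ + b * √(R / E) * √N' * φ)
        + 2 * b * (R / a ^ 2) * (√χ + 2 * √(R / b)) * t * √N' * φ) := by
  rw [← div_eq_mul_inv]
  set s := √(R / b)
  set X := a * √N * μ + b * √(R / E) * √N' * φ with hX
  set Z := t * √N' * φ with hZ
  have hs : 0 ≤ s := Real.sqrt_nonneg _
  have hZ0 : 0 ≤ Z := by positivity
  have hR : 0 < R := ha.trans_le haR
  have hX0 : 0 ≤ X := by positivity
  have hRa : 1 ≤ R / a := (one_le_div ha).2 haR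
  have hc : 1 ≤ √χ := Real.one_le_sqrt.2 hχ
  have e1 : 16 * t * R * (√N * μ + b / a * √(R / E) * √N' * φ) = 16 * (R / a * t * X) := by
    rw [hX]; field_simp
  have e2 : a * ((5 + 16 * ρ) * (R / a ^ 2) * t * X
      + 2 * b * (R / a ^ 2) * (√χ + 2 * s) * t * √N' * φ)
      = (5 + 16 * ρ) * (R / a * t * X) + R / a * (b * ((2 * √χ + 4 * s) * Z)) := by
    rw [hZ]; field_simp; ring
  rw [e1, e2]
  refine add_le_add (mul_le_mul_of_nonneg_right (by linarith) (by positivity)) ?_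
  refine le_trans ?_ (le_mul_of_one_le_left (by positivity) hRa)
  gcongr <;> linarith

section

variable {n p : ℕ} {Ω : Type*} [MeasurableSpace Ω] {P : Measure Ω} [IsProbabilityMeasure P]

lemma one_sub_le_measureReal {Q Q' : Ω → Prop} {c : ℝ} (hQ : P.real {ω | ¬ Q ω} ≤ c)
    (h : ∀ᵐ ω ∂P, Q ω → Q' ω) : 1 - c ≤ P.real {ω | Q' ω} := by
  have hae : (Set.univ : Set Ω) ≤ᵐ[P] ({ω | Q' ω} ∪ {ω | ¬ Q ω} : Set Ω) := by
    filter_upwards [h] with ω hω _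
    exact (em (Q ω)).imp hω id
  have h1 : P.real Set.univ ≤ P.real ({ω | Q' ω} ∪ {ω | ¬ Q ω}) :=
    ENNReal.toReal_mono (measure_ne_top P _) (measure_mono_ae hae)
  rw [probReal_univ] at h1
  have h2 := h1.trans (measureReal_union_le _ _)
  linarith

/-- High-probability bound on the distance between a random bias vector and its deterministic
equivalent, for a general matrix of link probabilities. -/
theorem le_measureReal_bias_sub_le {G : Ω → Fin n → Fin p → Bool} {q : Fin n → Fin p → ℝ}
    (hG : ∀ i j, Measurable fun ω => G ω i j)
    (hind : iIndepFun (fun (e : Fin n × Fin p) (ω : Ω) => G ω e.1 e.2) P)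
    (hlaw : ∀ i j, P {ω | G ω i j = true} = ENNReal.ofReal (q i j)) (hq : ∀ i j, 0 ≤ q i j)
    {a b t l M E D R χ μ φ : ℝ} (ha : 0 < a) (hb : 0 < b) (ht0 : 0 ≤ t) (ht : t ≤ 1) (hl : 0 < l)
    (hμ : 0 ≤ μ) (hφ : 0 ≤ φ) (hE0 : 0 < E) (hE : ∀ j, E ≤ (∑ i, q i j) + b) (hEM : E⁻¹ ≤ M)
    (hD0 : 0 < D) (hD : ∀ i, D ≤ (∑ j, q i j) + a) (hDM : D⁻¹ ≤ M) (hDR : D ≤ R) (haR : a ≤ R)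
    (hR : ∀ i, (∑ j, q i j) + a ≤ R) (hlM : 3 * M * l = t ^ 2) (hχ : 1 ≤ χ)
    {m : Fin n → ℝ} {v : Fin p → ℝ} (hm : ∀ i, |m i| ≤ μ) (hv : ∀ j, |v j| ≤ φ)
    {x : Ω → Fin n → ℝ} {z : Ω → EuclideanSpace ℝ (Fin n)} (hz : ∀ᵐ ω ∂P, z ω = WithLp.toLp 2 (x ω))
    (hx : ∀ ω i, lap (adj (G ω)) a b (x ω) i = -(a * m i) + b * transfer (adj (G ω)) b v i) :
    1 - (8 * n + 6 * p) * Real.exp (-l) ≤ P.real {ω |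
      ‖z ω - WithLp.toLp 2 ((Lw (of q) a b)⁻¹ *ᵥ
        (-(a • m) + b • ((of q * (Df (of q) b)⁻¹) *ᵥ v)))‖ ≤
      (5 + 16 * (R / D)) * (R / a ^ 2) * t * (a * √(n : ℝ) * μ + b * √(R / E) * √(p : ℝ) * φ)
        + 2 * b * (R / a ^ 2) * (√χ + 2 * √(R / b)) * t * √(p : ℝ) * φ} := by
  set x₁ := (Lw (of q) a b)⁻¹ *ᵥ (-(a • m)) with hx₁
  set x₂ := (Lw (of q) a b)⁻¹ *ᵥ (b • ((of q * (Df (of q) b)⁻¹) *ᵥ v)) with hx₂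
  have hMR : 1 ≤ M * R := by
    rw [← inv_mul_cancel₀ hD0.ne']
    exact mul_le_mul hDM hDR hD0.le ((inv_pos.2 hD0).le.trans hDM)
  have hmain := measureReal_not_nrm_bias_sub_le (x₁ := x₁) (x₂ := x₂) hG hind hlaw hq ha hb ht0 ht
    hl hμ hφ (inv_pos.2 hE0).le (fun j => inv_anti₀ hE0 (hE j)) hEM
    (fun i => (inv_anti₀ hD0 (hD i)).trans hDM) hR (hD0.le.trans hDR) hMR hlM hm hv
    (fun i => by rw [hx₁, lap_Lw_inv_mulVec hq ha hb]; rfl)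
    (fun i => by rw [hx₂, lap_Lw_inv_mulVec hq ha hb, mul_Df_inv_mulVec hq hb]; rfl)
  rw [Fintype.card_fin, Fintype.card_fin] at hmain
  have hbound := bias_bound_le (E := E) (N := n) (N' := p) ha hb ht0 haR ((one_le_div hD0).2 hDR)
    hχ hμ hφ
  rw [Matrix.mulVec_add, ← hx₁, ← hx₂]
  refine one_sub_le_measureReal hmain ?_
  filter_upwards [hz] with ω hω h
  rw [hω]
  exact le_of_mul_le_mul_left ((h (x ω) (hx ω)).trans hbound) ha

end

end TwoWay

end

theorem mainTheorem4 {n p K : ℕ} (S : BlockModel n p K)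
    {Ω : Type*} [MeasurableSpace Ω] (P : Measure Ω) [IsProbabilityMeasure P]
    -- the random network: independent Bernoulli links with success probabilities `p_{ij}`
    (G : Ω → Fin n → Fin p → Bool) (hG : Measurable G)
    (hG_indep : iIndepFun (fun (e : Fin n × Fin p) (ω : Ω) => G ω e.1 e.2) P)
    (hG_law : ∀ i j, P {ω | G ω i j = true} = ENNReal.ofReal (S.meanB i j))
    -- individual effects around the group effects, and outcome errors
    (muStar phiStar : EuclideanSpace ℝ (Fin K))
    (Uw : Ω → Fin n → ℝ) (Uf : Ω → Fin p → ℝ) (U : Ω → Fin n → Fin p → ℝ)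
    (hUw : Measurable Uw) (hUf : Measurable Uf) (hU : Measurable U)
    (hUw_int : ∀ i, Integrable (fun ω => Uw ω i) P)
    (hUf_int : ∀ j, Integrable (fun ω => Uf ω j) P)
    (hU_int : ∀ i j, Integrable (fun ω => U ω i j) P)
    (hUw_mean : ∀ i, ∫ ω, Uw ω i ∂P = 0)
    (hUf_mean : ∀ j, ∫ ω, Uf ω j ∂P = 0)
    (hU_mean : ∀ i j, ∫ ω, U ω i j ∂P = 0)
    (hUw_indep : IndepFun Uw G P) (hUf_indep : IndepFun Uf G P) (hU_indep : IndepFun U G P)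
    (mu : Ω → Fin n → ℝ) (hmu : ∀ ω, mu ω = S.Zw *ᵥ muStar.ofLp + Uw ω)
    (phi : Ω → Fin p → ℝ) (hphi : ∀ ω, phi ω = S.Zf *ᵥ phiStar.ofLp + Uf ω)
    -- ridge parameters, tolerance and the condition on the expected degrees
    (lw lf : ℝ) (hlw : 0 < lw) (hlf : 0 < lf) (ε : ℝ) (hε : 0 < ε)
    (hM : S.M lw lf ≤ (3 * Real.log (((n : ℝ) + p) / ε))⁻¹)
    (γ : ℝ) (hγ : γ = (p : ℝ) / n) :
    1 - (11 + 7 * γ) / (1 + γ) * ε ≤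
      P.real {ω |
        ‖TwoWay.biasMu P G lw lf mu phi U ω - TwoWay.meanBiasMu S lw lf muStar phiStar‖ ≤
          (5 + 16 * ((S.maxW + lw) / (S.minW + lw))) * ((S.maxW + lw) / lw ^ 2) * S.t lw lf ε *
              (lw * √(n : ℝ) * ‖muStar‖ +
                lf * √((S.maxW + lw) / (S.minF + lf)) * √(p : ℝ) * ‖phiStar‖) +
            2 * lf * ((S.maxW + lw) / lw ^ 2) *
              (√(S.chiF lf) + 2 * √((S.maxW + lw) / lf)) * S.t lw lf ε *
                √(p : ℝ) * ‖phiStar‖} ∧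
    1 - (6 + 12 * γ) / (1 + γ) * ε ≤
      P.real {ω |
        ‖TwoWay.biasPhi P G lw lf mu phi U ω - TwoWay.meanBiasPhi S lw lf muStar phiStar‖ ≤
          (5 + 16 * ((S.maxF + lf) / (S.minF + lf))) * ((S.maxF + lf) / lf ^ 2) * S.t lw lf ε *
              (lf * √(p : ℝ) * ‖phiStar‖ +
                lw * √((S.maxF + lf) / (S.minW + lw)) * √(n : ℝ) * ‖muStar‖) +
            2 * lw * ((S.maxF + lf) / lf ^ 2) *
              (√(S.chiW lw) + 2 * √((S.maxF + lf) / lw)) * S.t lw lf ε *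
                √(n : ℝ) * ‖muStar‖} := by
  -- If `K = 0` then `n = p = 0`, and with `log 0 = 0` and `0⁻¹ = 0` the condition on `M` reads `M ≤
  -- 0`, which is impossible.
  have hK : Nonempty (Fin K) := by
    by_contra hK
    rw [not_nonempty_iff] at hK
    have hn : n = 0 := by
      by_contra hn
      exact hK.elim (S.k ⟨0, Nat.pos_of_ne_zero hn⟩)
    have hp : p = 0 := by
      by_contra hp
      exact hK.elim (S.l ⟨0, Nat.pos_of_ne_zero hp⟩)
    subst hn hp
    have h1 : (S.minF + lf)⁻¹ ≤ 0 := by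
      refine (le_max_left _ _).trans (hM.trans ?_)
      simp
    have h2 : 0 < (S.minF + lf)⁻¹ := inv_pos.2 (by linarith [S.minF_nonneg])
    linarith
  obtain ⟨k₀⟩ := hK
  obtain ⟨i₀, -⟩ := S.k_surjective k₀
  -- Without firms the weights of a group would sum to 0, not 1.
  have hj : Nonempty (Fin p) := by
    by_contra hj
    rw [not_nonempty_iff] at hj
    have := S.theta_sum k₀
    simp at this
  obtain ⟨j₀⟩ := hj
  have hn : (0 : ℝ) < n := by exact_mod_cast i₀.pos
  have hp : (0 : ℝ) < p := by exact_mod_cast j₀.pos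
  have hE0 : 0 < S.minF + lf := by linarith [S.minF_nonneg]
  have hD0 : 0 < S.minW + lw := by linarith [S.minW_nonneg]
  have hEM : (S.minF + lf)⁻¹ ≤ S.M lw lf := le_max_left _ _
  have hDM : (S.minW + lw)⁻¹ ≤ S.M lw lf := le_max_right _ _
  have hM0 : 0 < S.M lw lf := (inv_pos.2 hE0).trans_le hEM
  set l := Real.log (((n : ℝ) + p) / ε) with hldef
  -- Since `M > 0`, the condition on `M` forces `3 * l > 0`, that is `ε < n + p`.
  have hl : 0 < l := by
    have := inv_pos.1 (hM0.trans_le hM)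
    linarith
  have hMl : 3 * S.M lw lf * l ≤ 1 := by
    have := mul_le_mul_of_nonneg_right hM (show 0 ≤ 3 * l by linarith)
    rw [inv_mul_cancel₀ (by positivity)] at this
    linarith
  have ht0 : 0 ≤ S.t lw lf ε := Real.sqrt_nonneg _
  have ht2 : 3 * S.M lw lf * l = S.t lw lf ε ^ 2 := by
    rw [BlockModel.t, Real.sq_sqrt (by positivity)]
  have ht : S.t lw lf ε ≤ 1 := Real.sqrt_le_one.2 hMl
  have hexp : Real.exp (-l) = ε / (n + p) := by
    rw [Real.exp_neg, hldef, Real.exp_log (by positivity), inv_div]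
  have hW := (S.minW_le k₀).trans (S.le_maxW k₀)
  have hF := (S.minF_le j₀).trans (S.le_maxF j₀)
  have hm : ∀ i, |(S.Zw *ᵥ muStar.ofLp) i| ≤ ‖muStar‖ := fun i => by
    rw [S.Zw_mulVec]; exact PiLp.norm_apply_le muStar _
  have hv : ∀ j, |(S.Zf *ᵥ phiStar.ofLp) j| ≤ ‖phiStar‖ := fun j => by
    rw [S.Zf_mulVec]; exact PiLp.norm_apply_le phiStar _
  have hGm : ∀ i j, Measurable fun ω => G ω i j := fun i j =>
    (measurable_pi_apply j).comp ((measurable_pi_apply i).comp hG)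
  constructor
  · refine le_trans ?_ (TwoWay.le_measureReal_bias_sub_le (q := fun i j => S.meanB i j) hGm hG_indep
      hG_law S.meanB_nonneg hlw hlf ht0 ht hl (norm_nonneg muStar) (norm_nonneg phiStar)
      hE0 (fun j => by rw [S.sum_meanB_col]; linarith [S.minF_le j]) hEM
      hD0 (fun i => by rw [S.sum_meanB_row]; linarith [S.minW_le (S.k i)]) hDM
      (by linarith) (by linarith [S.minW_nonneg])
      (fun i => by rw [S.sum_meanB_row]; linarith [S.le_maxW (S.k i)]) ht2
      (le_max_left 1 (S.maxW / (S.minF + lf))) hm hv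
      (TwoWay.biasMu_ae_eq hG hUw hUf hU hUw_int hUf_int hU_int
        hUw_mean hUf_mean hU_mean hUw_indep hUf_indep hU_indep hmu hphi hlw hlf)
      (fun ω i => TwoWay.lap_of_normalMatrix hlf
        (TwoWay.normalMatrix_mulVec_biasVec (G ω) hlw hlf _ _) i))
    -- The failure probability obtained has `8n + 6p` in place of `11n + 7p`.
    have e : (11 + 7 * γ) / (1 + γ) * ε = (11 * n + 7 * p) * (ε / (n + p)) := by
      rw [hγ]; field_simp
    rw [hexp, e]
    have : 0 ≤ ε / (n + p : ℝ) := by positivity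
    nlinarith
  -- The same estimate for the transposed network, with `8p + 6n ≤ 6n + 12p`.
  · refine le_trans ?_ (TwoWay.le_measureReal_bias_sub_le (G := fun ω j i => G ω i j)
      (q := fun j i => S.meanB i j) (fun j i => hGm i j)
      (hG_indep.precomp (g := Prod.swap) Prod.swap_injective)
      (fun j i => hG_law i j) (fun j i => S.meanB_nonneg i j) hlf hlw ht0 ht hl
      (norm_nonneg phiStar) (norm_nonneg muStar)
      hD0 (fun i => by rw [S.sum_meanB_row]; linarith [S.minW_le (S.k i)]) hDM
      hE0 (fun j => by rw [S.sum_meanB_col]; linarith [S.minF_le j]) hEM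
      (by linarith) (by linarith [S.minF_nonneg])
      (fun j => by rw [S.sum_meanB_col]; linarith [S.le_maxF j]) ht2
      (le_max_left 1 (S.maxF / (S.minW + lw))) hv hm
      (TwoWay.biasPhi_ae_eq hG hUw hUf hU hUw_int hUf_int hU_int
        hUw_mean hUf_mean hU_mean hUw_indep hUf_indep hU_indep hmu hphi hlw hlf)
      (fun ω j => TwoWay.lap_transpose_of_normalMatrix hlw
        (TwoWay.normalMatrix_mulVec_biasVec (G ω) hlw hlf _ _) j))
    have e : (6 + 12 * γ) / (1 + γ) * ε = (6 * n + 12 * p) * (ε / (n + p)) := by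
      rw [hγ]; field_simp
    rw [hexp, e]
    have : 0 ≤ ε / (n + p : ℝ) := by positivity
    nlinarith
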